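/- Notation. All distributions are complex valued. $\mathcal S'_+(\mathbb R)$ is the space of tempered distributions on $\mathbb R$ supported in $[0,\infty)$, and $\mathcal S'(\mathbb R\times\mathbb R_+)$ the space of tempered distributions $w(x,t)$ on $\mathbb R^2$ vanishing for $t<0$. For $\Lambda\in\mathcal S'_+(\mathbb R)$ and $w\in\mathcal S'(\mathbb R\times\mathbb R_+)$, $\Lambda*_t w$ is the convolution in $t$, $\langle \Lambda*_t w,\varphi\rangle=\langle\Lambda(\tau),\langle w(x,t),\varphi(x,t+\tau)\rangle\rangle$. Let $f_\beta(t)=H(t)t^{\beta-1}/\Gamma(\beta)$ for $\beta>0$ and $f_\beta=\frac{d^N}{dt^N}f_{\beta+N}$ for $\beta\le 0$, $\beta+N>0$; put ${}_0D_t^\alpha y=f_{-\alpha}*_t y$. For a compactly supported distribution $\phi$ on $\mathbb R$ with support in $[0,1]$, the distributed order derivative of $y$ is given by $\langle\int_0^1\phi(\alpha)\,{}_0D_t^\alpha y\,d\alpha,\varphi\rangle=\langle\phi(\alpha),\langle{}_0D_t^\alpha y,\varphi\rangle\rangle$, $\varphi\in\mathcal S(\mathbb R^2)$. Theorem. Let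 $\phi_\sigma,\phi_\varepsilon\in\mathcal E'(\mathbb R)$ have support in $[0,1]$ and put $\Phi_\sigma(s)=\langle\phi_\sigma(\alpha),s^\alpha\rangle$, $\Phi_\varepsilon(s)=\langle\phi_\varepsilon(\alpha),s^\alpha\rangle$ for $\operatorname{Re}s>0$. Assume (A1): $\mathcal L^{-1}(\Phi_\varepsilon/\Phi_\sigma)$ exists in $\mathcal S'_+(\mathbb R)$; that is, $\Phi_\sigma\not\equiv0$ on $\operatorname{Re}s>0$ and there is $\Lambda\in\mathcal S'_+(\mathbb R)$ whose Laplace transform $\langle\Lambda(t),e^{-st}\rangle$ equals $\Phi_\varepsilon(s)/\Phi_\sigma(s)$ for all $s$ with $\operatorname{Re}s>0$ and $\Phi_\sigma(s)\ne0$. Then the system $$\partial_x\sigma=\partial_t^2u\ \ (t>0),\qquad \int_0^1\phi_\sigma(\alpha)\,{}_0D_t^\alpha\sigma\,d\alpha=\int_0^1\phi_\varepsilon(\alpha)\,{}_0D_t^\alpha\varepsilon\,d\alpha,\qquad \varepsilon=\partial_xu \tag{S}$$ (the last two equations holding in $\mathcal S'(\mathbb R\times\mathbb R_+)$) and the wave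 equation $$\partial_t^2u-\Lambda*_t\partial_x^2u=0\qquad(t>0) \tag{W}$$ are equivalent in the following sense. (1) For all $u,\sigma,\varepsilon\in\mathcal S'(\mathbb R\times\mathbb R_+)$: $(u,\sigma,\varepsilon)$ solves (S) if and only if $u$ solves (W), $\varepsilon=\partial_xu$ and $\sigma=\Lambda*_t\varepsilon$. (2) For every $u\in\mathcal S'(\mathbb R\times\mathbb R_+)$: $u$ solves (W) if and only if there are $\sigma,\varepsilon\in\mathcal S'(\mathbb R\times\mathbb R_+)$ such that $(u,\sigma,\varepsilon)$ solves (S). For all $u_0,v_0\in\mathcal S'(\mathbb R)$, (1) and (2) also hold with the equation of motion in (S) replaced by $\partial_x\sigma+u_0(x)\delta'(t)+v_0(x)\delta(t)=\partial_t^2u$ and (W) replaced by $\partial_t^2u-\Lambda*_t\partial_x^2u=u_0(x)\delta'(t)+v_0(x)\delta(t)$, both as equalities in $\mathcal S'(\mathbb R^2)$. -/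

import Mathlib

open scoped SchwartzMap Distributions

namespace FracWave

noncomputable section

open scoped ContDiff
open LineDeriv MeasureTheory TopologicalSpace

/-! Points of `ℝ × ℝ` are written `(x, t)`: first coordinate space, second coordinate time.
All distributions are complex valued. -/

/-- A fixed smooth cutoff in time: `0` for `t ≤ -1` and `1` for `-1/2 ≤ t`. Distributions supported in
`t ≥ 0` do not see the choice of this cutoff. -/
def cut (t : ℝ) : ℂ := (Real.smoothTransition (2 * t + 2) : ℂ)

theorem cut_of_nonneg {t : ℝ} (ht : -(1 / 2) ≤ t) : cut t = 1 := by
  simp [cut, Real.smoothTransition.one_of_one_le (show (1 : ℝ) ≤ 2 * t + 2 by linarith)]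

theorem cut_of_le {t : ℝ} (ht : t ≤ -1) : cut t = 0 := by
  simp [cut, Real.smoothTransition.zero_of_nonpos (show 2 * t + 2 ≤ (0 : ℝ) by linarith)]

theorem cut_contDiff : ContDiff ℝ ∞ cut := by
  have h : ContDiff ℝ ∞ (fun t : ℝ => Real.smoothTransition (2 * t + 2)) :=
    (Real.smoothTransition.contDiff (n := ⊤)).comp
      ((contDiff_const.mul contDiff_id).add contDiff_const)
  exact Complex.ofRealCLM.contDiff.comp h

theorem cut_hasTemperateGrowth : cut.HasTemperateGrowth := by
  have hc : HasCompactSupport (fderiv ℝ cut) := by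
    refine HasCompactSupport.of_support_subset_isCompact (isCompact_Icc (a := (-1 : ℝ)) (b := 0)) ?_
    intro t ht
    by_contra hn
    apply ht
    rw [Set.mem_Icc, not_and_or, not_le, not_le] at hn
    rcases hn with hn | hn
    · have : cut =ᶠ[nhds t] fun _ => (0 : ℂ) := by
        filter_upwards [Iio_mem_nhds hn] with y hy using cut_of_le (le_of_lt hy)
      rw [this.fderiv_eq]; simp
    · have : cut =ᶠ[nhds t] fun _ => (1 : ℂ) := by
        filter_upwards [Ioi_mem_nhds hn] with y hy
        exact cut_of_nonneg (by have : (0 : ℝ) < y := hy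
                                linarith)
      rw [this.fderiv_eq]; simp
  refine Function.HasTemperateGrowth.of_fderiv
    (hc.hasTemperateGrowth (cut_contDiff.fderiv_right (by simp)))
    (cut_contDiff.differentiable (by simp)) (k := 0) (C := 1) (fun t => ?_)
  simp only [cut, Complex.norm_real, pow_zero, mul_one]
  rw [Real.norm_of_nonneg (Real.smoothTransition.nonneg _)]
  exact Real.smoothTransition.le_one _

theorem cut_snd_hasTemperateGrowth :
    (fun p : ℝ × ℝ => cut p.2).HasTemperateGrowth :=
  cut_hasTemperateGrowth.comp (ContinuousLinearMap.snd ℝ ℝ ℝ).hasTemperateGrowth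

/-- Multiplication of a test function by the time cutoff. -/
def timeCutoff : 𝓢(ℝ × ℝ, ℂ) →L[ℂ] 𝓢(ℝ × ℝ, ℂ) :=
  SchwartzMap.smulLeftCLM ℂ (fun p : ℝ × ℝ => cut p.2)

/-- The translation `φ(x, t) ↦ φ(x, t + τ)`. -/
def timeShift (τ : ℝ) : 𝓢(ℝ × ℝ, ℂ) →L[ℂ] 𝓢(ℝ × ℝ, ℂ) :=
  SchwartzMap.compSubConstCLM ℂ ((0, -τ) : ℝ × ℝ)

theorem timeCutoff_apply (φ : 𝓢(ℝ × ℝ, ℂ)) (p : ℝ × ℝ) :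
    timeCutoff φ p = cut p.2 * φ p := by
  simp [timeCutoff, SchwartzMap.smulLeftCLM_apply_apply cut_snd_hasTemperateGrowth]

theorem timeShift_apply (τ : ℝ) (φ : 𝓢(ℝ × ℝ, ℂ)) (p : ℝ × ℝ) :
    timeShift τ φ p = φ (p.1, p.2 + τ) := by
  rcases p with ⟨x, t⟩
  simp [timeShift]

theorem fderiv_iteratedFDeriv_apply {E : Type} [NormedAddCommGroup E] [NormedSpace ℝ E] (n : ℕ) :
    ∀ {F : Type} [NormedAddCommGroup F] [NormedSpace ℝ F] (f : E → F) (_ : ContDiff ℝ ∞ f) (x e : E),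
      fderiv ℝ (iteratedFDeriv ℝ n f) x e = iteratedFDeriv ℝ n (fun y => fderiv ℝ f y e) x := by
  induction n with
  | zero =>
    intro F _ _ f hf x e
    ext m
    rw [iteratedFDeriv_zero_eq_comp, LinearIsometryEquiv.comp_fderiv]
    simp
  | succ n ih =>
    intro F _ _ f hf x e
    have hf' : ContDiff ℝ ∞ (fderiv ℝ f) := hf.fderiv_right (by simp)
    have key : fderiv ℝ (fun y => fderiv ℝ f y e) = fun y => fderiv ℝ (fderiv ℝ f) y e := by
      funext y
      ext v
      have hs : IsSymmSndFDerivAt ℝ f y := hf.contDiffAt.isSymmSndFDerivAt (by simp; exact WithTop.coe_le_coe.2 (le_top : (2 : ℕ∞) ≤ ⊤))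
      rw [fderiv_clm_apply (hf'.differentiable (by simp) y) (by simp)]
      simpa using hs v e
    have h1 : iteratedFDeriv ℝ (n + 1) f = _ := funext fun y => iteratedFDeriv_succ_eq_comp_right
    have h2 : iteratedFDeriv ℝ n (fderiv ℝ (fun y => fderiv ℝ f y e)) x
        = fderiv ℝ (iteratedFDeriv ℝ n (fderiv ℝ f)) x e := by
      rw [key, ih _ hf' x e]
    rw [iteratedFDeriv_succ_eq_comp_right, h1]
    have hd : DifferentiableAt ℝ (iteratedFDeriv ℝ n (fderiv ℝ f)) x :=
      hf'.differentiable_iteratedFDeriv (by exact_mod_cast WithTop.coe_lt_top _) x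
    have h3 := ((continuousMultilinearCurryRightEquiv' ℝ n E
      F).symm.toContinuousLinearEquiv.toContinuousLinearMap.hasFDerivAt.comp x hd.hasFDerivAt).fderiv
    have h4 := congrArg (fun L => L e) h3
    simp only [Function.comp_apply]
    erw [h2]
    exact h4


theorem norm_taylor_two {V : Type} [NormedAddCommGroup V] [NormedSpace ℝ V] {c c' c'' : ℝ → V}
    (h1 : ∀ θ, HasDerivAt c (c' θ) θ) (h2 : ∀ θ, HasDerivAt c' (c'' θ) θ) {M : ℝ}
    (hM : ∀ θ ∈ Set.Icc (-1 : ℝ) 1, ‖c'' θ‖ ≤ M) {h : ℝ} (hh : |h| ≤ 1) :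
    ‖c h - c 0 - h • c' 0‖ ≤ M * h ^ 2 := by
  have hM0 : 0 ≤ M := (norm_nonneg _).trans (hM 0 (by simp))
  have A : ∀ θ ∈ Set.Icc (-1 : ℝ) 1, ‖c' θ - c' 0‖ ≤ M * |θ| := by
    intro θ hθ
    have := (convex_Icc (-1 : ℝ) 1).norm_image_sub_le_of_norm_hasDerivWithin_le
      (fun y _ => (h2 y).hasDerivWithinAt) hM (x := 0) (by simp) hθ
    simpa using this
  have hsub : ∀ y ∈ Set.uIcc (0 : ℝ) h, |y| ≤ |h| := by
    intro y hy
    have := Set.abs_sub_left_of_mem_uIcc hy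
    simpa using this
  have B := (convex_uIcc (0 : ℝ) h).norm_image_sub_le_of_norm_hasDerivWithin_le
      (f := fun θ => c θ - θ • c' 0) (f' := fun θ => c' θ - c' 0) (C := M * |h|)
      (fun y _ => by
        have h3 : HasDerivAt (fun θ : ℝ => θ • c' 0) ((1 : ℝ) • c' 0) y :=
          (hasDerivAt_id y).smul_const (c' 0)
        have := (h1 y).sub h3
        rw [one_smul] at this
        exact this.hasDerivWithinAt)
      (fun y hy => (A y (abs_le.1 ((hsub y hy).trans hh))).trans
        (mul_le_mul_of_nonneg_left (hsub y hy) hM0))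
      (x := 0) (y := h) Set.left_mem_uIcc Set.right_mem_uIcc
  have e : c h - h • c' 0 - (c 0 - (0 : ℝ) • c' 0) = c h - c 0 - h • c' 0 := by
    simp; abel
  simp only [e, sub_zero, Real.norm_eq_abs] at B
  calc _ ≤ _ := B
    _ = M * h ^ 2 := by rw [mul_assoc, abs_mul_abs_self, sq]

/-- The time derivative of a test function. -/
abbrev dt (φ : 𝓢(ℝ × ℝ, ℂ)) : 𝓢(ℝ × ℝ, ℂ) := ∂_{((0 : ℝ), (1 : ℝ))} φ

theorem timeShift_coe (τ : ℝ) (φ : 𝓢(ℝ × ℝ, ℂ)) :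
    (timeShift τ φ : ℝ × ℝ → ℂ) = fun p => φ (p + (0, τ)) := by
  funext p
  rw [timeShift_apply]
  congr 1
  ext <;> simp

theorem hasDerivAt_iteratedFDeriv (n : ℕ) (φ : 𝓢(ℝ × ℝ, ℂ)) (p : ℝ × ℝ) (θ : ℝ) :
    HasDerivAt (fun θ : ℝ => iteratedFDeriv ℝ n φ (p + θ • ((0 : ℝ), (1 : ℝ))))
      (iteratedFDeriv ℝ n (dt φ) (p + θ • ((0 : ℝ), (1 : ℝ)))) θ := by
  have h0 : Differentiable ℝ (iteratedFDeriv ℝ n φ) :=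
    φ.smooth'.differentiable_iteratedFDeriv (by exact_mod_cast WithTop.coe_lt_top _)
  have h1 : HasDerivAt (fun θ : ℝ => p + θ • ((0 : ℝ), (1 : ℝ))) ((1 : ℝ) • ((0 : ℝ), (1 : ℝ))) θ :=
    ((hasDerivAt_id θ).smul_const _).const_add p
  have h2 := (h0 (p + θ • ((0 : ℝ), (1 : ℝ)))).hasFDerivAt.comp_hasDerivAt θ h1
  have h3 := fderiv_iteratedFDeriv_apply n φ φ.smooth' (p + θ • ((0 : ℝ), (1 : ℝ))) (0, 1)
  rw [one_smul, h3] at h2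
  exact h2

theorem dt_timeShift (τ : ℝ) (φ : 𝓢(ℝ × ℝ, ℂ)) : dt (timeShift τ φ) = timeShift τ (dt φ) := by
  ext p
  simp only [timeShift_coe, SchwartzMap.lineDerivOp_apply_eq_fderiv]
  rw [fderiv_comp_add_right]

theorem timeShift_add (τ h : ℝ) (φ : 𝓢(ℝ × ℝ, ℂ)) :
    timeShift (τ + h) φ = timeShift h (timeShift τ φ) := by
  ext p
  simp only [timeShift_apply]
  congr 2
  ring

theorem iteratedFDeriv_timeShift (n : ℕ) (τ : ℝ) (φ : 𝓢(ℝ × ℝ, ℂ)) (p : ℝ × ℝ) :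
    iteratedFDeriv ℝ n (timeShift τ φ) p = iteratedFDeriv ℝ n φ (p + (0, τ)) := by
  rw [timeShift_coe, iteratedFDeriv_comp_add_right]

theorem seminorm_timeShift_sub (k n : ℕ) (φ : 𝓢(ℝ × ℝ, ℂ)) :
    ∃ C : ℝ, ∀ h : ℝ, |h| ≤ 1 →
      SchwartzMap.seminorm ℂ k n (timeShift h φ - φ - (h : ℂ) • dt φ) ≤ C * h ^ 2 := by
  set S := 2 ^ k * (Finset.Iic (k, n)).sup (fun m => SchwartzMap.seminorm ℂ m.1 m.2) (dt (dt φ))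
    with hS
  have hS0 : 0 ≤ S := by positivity
  refine ⟨2 ^ k * S, fun h hh => SchwartzMap.seminorm_le_bound ℂ k n _ (by positivity) fun p => ?_⟩
  set M : ℝ := 2 ^ k * S / (1 + ‖p‖) ^ k with hMdef
  have hp : 0 < (1 + ‖p‖) ^ k := by positivity
  have hM : ∀ θ ∈ Set.Icc (-1 : ℝ) 1,
      ‖iteratedFDeriv ℝ n (dt (dt φ)) (p + θ • ((0 : ℝ), (1 : ℝ)))‖ ≤ M := by
    intro θ hθ
    set q := p + θ • ((0 : ℝ), (1 : ℝ)) with hq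
    have h1 : 1 + ‖p‖ ≤ 2 * (1 + ‖q‖) := by
      have : ‖p‖ ≤ ‖q‖ + ‖θ • ((0 : ℝ), (1 : ℝ))‖ := by
        have := norm_sub_le q (θ • ((0 : ℝ), (1 : ℝ)))
        rwa [hq, add_sub_cancel_right] at this
      have h3 : ‖θ • ((0 : ℝ), (1 : ℝ))‖ ≤ 1 := by
        rw [norm_smul, Prod.norm_def]
        simpa using abs_le.2 hθ
      linarith [norm_nonneg q]
    have h2 := SchwartzMap.one_add_le_sup_seminorm_apply (𝕜 := ℂ) (m := (k, n)) le_rfl le_rfl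
      (dt (dt φ)) q
    rw [hMdef, le_div_iff₀ hp]
    calc _ ≤ ‖iteratedFDeriv ℝ n (dt (dt φ)) q‖ * (2 * (1 + ‖q‖)) ^ k := by gcongr
      _ = 2 ^ k * ((1 + ‖q‖) ^ k * ‖iteratedFDeriv ℝ n (dt (dt φ)) q‖) := by rw [mul_pow]; ring
      _ ≤ _ := by gcongr
  have key := norm_taylor_two (fun θ => hasDerivAt_iteratedFDeriv n φ p θ)
    (fun θ => hasDerivAt_iteratedFDeriv n (dt φ) p θ) hM hh
  have e : iteratedFDeriv ℝ n (timeShift h φ - φ - (h : ℂ) • dt φ) p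
      = iteratedFDeriv ℝ n φ (p + h • ((0 : ℝ), (1 : ℝ)))
        - iteratedFDeriv ℝ n φ (p + (0 : ℝ) • ((0 : ℝ), (1 : ℝ)))
        - h • iteratedFDeriv ℝ n (dt φ) (p + (0 : ℝ) • ((0 : ℝ), (1 : ℝ))) := by
    have c1 := ((timeShift h φ).smooth n).contDiffAt (x := p)
    have c2 := (φ.smooth n).contDiffAt (x := p)
    have c3 := ((dt φ).smooth n).contDiffAt (x := p)
    have e1 : ((timeShift h φ - φ - (h : ℂ) • dt φ : 𝓢(ℝ × ℝ, ℂ)) : ℝ × ℝ → ℂ)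
        = (⇑(timeShift h φ) - ⇑φ) - h • ⇑(dt φ) := by
      ext p; simp
    rw [e1, iteratedFDeriv_sub_apply (f := ⇑(timeShift h φ) - ⇑φ) (g := h • ⇑(dt φ)) (c1.sub c2)
      (c3.const_smul h), iteratedFDeriv_sub_apply c1 c2, iteratedFDeriv_const_smul_apply c3, iteratedFDeriv_timeShift]
    simp
  rw [e]
  calc _ ≤ (1 + ‖p‖) ^ k * (M * h ^ 2) := by
        gcongr
        linarith
    _ = 2 ^ k * S * h ^ 2 := by rw [hMdef]; field_simp

theorem hasDerivAt_timeShift (W : 𝓢(ℝ × ℝ, ℂ) →L[ℂ] ℂ) (φ : 𝓢(ℝ × ℝ, ℂ)) (τ : ℝ) :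
    HasDerivAt (fun τ => W (timeShift τ φ)) (W (timeShift τ (dt φ))) τ := by
  rw [hasDerivAt_iff_isLittleO_nhds_zero]
  have hq : Continuous ((normSeminorm ℂ ℂ).comp W.toLinearMap) := by
    exact continuous_norm.comp W.continuous
  obtain ⟨s, C, -, hC⟩ := Seminorm.bound_of_continuous (schwartz_withSeminorms ℂ (ℝ × ℝ) ℂ) _ hq
  choose D hD using fun m : ℕ × ℕ => seminorm_timeShift_sub m.1 m.2 (timeShift τ φ)
  have hb : (fun h : ℝ => W (timeShift (τ + h) φ) - W (timeShift τ φ) - h • W (timeShift τ (dt φ)))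
      =O[nhds 0] fun h : ℝ => h ^ 2 := by
    refine Asymptotics.IsBigO.of_bound ((C : ℝ) * ∑ i ∈ s, D i) ?_
    filter_upwards [Icc_mem_nhds (show (-1 : ℝ) < 0 by norm_num) (show (0 : ℝ) < 1 by norm_num)]
      with h hh
    have hh' : |h| ≤ 1 := abs_le.2 hh
    set R := timeShift h (timeShift τ φ) - timeShift τ φ - (h : ℂ) • dt (timeShift τ φ) with hR
    have e : W (timeShift (τ + h) φ) - W (timeShift τ φ) - h • W (timeShift τ (dt φ)) = W R := by
      rw [hR, map_sub, map_sub, map_smul, dt_timeShift, timeShift_add]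
      simp
    have h1 : ‖W R‖ ≤ C * (s.sup (schwartzSeminormFamily ℂ (ℝ × ℝ) ℂ)) R := hC R
    have h2 : (s.sup (schwartzSeminormFamily ℂ (ℝ × ℝ) ℂ)) R
        ≤ ∑ i ∈ s, schwartzSeminormFamily ℂ (ℝ × ℝ) ℂ i R := by
      have := Seminorm.finset_sup_le_sum (schwartzSeminormFamily ℂ (ℝ × ℝ) ℂ) s R
      simpa using this
    have h3 : ∑ i ∈ s, schwartzSeminormFamily ℂ (ℝ × ℝ) ℂ i R ≤ ∑ i ∈ s, D i * h ^ 2 :=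
      Finset.sum_le_sum fun i _ => hD i h hh'
    rw [e]
    calc _ ≤ _ := h1
      _ ≤ C * ∑ i ∈ s, D i * h ^ 2 := by gcongr; exact h2.trans h3
      _ = _ := by
        rw [← Finset.sum_mul, mul_assoc, Real.norm_of_nonneg (sq_nonneg h)]
  refine hb.trans_isLittleO ?_
  simpa using Asymptotics.isLittleO_pow_id (𝕜 := ℝ) (show 1 < 2 by norm_num)


theorem seminorm_cut_timeShift (l : ℕ) (i : ℕ × ℕ) :
    ∃ (m : ℕ × ℕ) (C : ℝ), 0 ≤ C ∧ ∀ (φ : 𝓢(ℝ × ℝ, ℂ)) (τ : ℝ), -1 ≤ τ →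
      (1 + |τ|) ^ l * SchwartzMap.seminorm ℂ i.1 i.2 (timeCutoff (timeShift τ φ)) ≤
        C * (Finset.Iic m).sup (schwartzSeminormFamily ℂ (ℝ × ℝ) ℂ) φ := by
  obtain ⟨k, n⟩ := i
  obtain ⟨k₁, C₁, hC₁, hcut⟩ := cut_snd_hasTemperateGrowth.norm_iteratedFDeriv_le_uniform n
  set K := k + k₁ + l with hK
  refine ⟨(K, n), 2 ^ n * C₁ * 2 ^ K * 2 ^ K, by positivity, fun φ τ hτ => ?_⟩
  set S := (Finset.Iic (K, n)).sup (schwartzSeminormFamily ℂ (ℝ × ℝ) ℂ) φ with hS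
  have hS0 : 0 ≤ S := apply_nonneg _ _
  have hl : 0 < (1 + |τ|) ^ l := by positivity
  rw [← le_div_iff₀' hl]
  refine SchwartzMap.seminorm_le_bound ℂ k n _ (by positivity) fun p => ?_
  rw [le_div_iff₀' hl]
  have hfun : (timeCutoff (timeShift τ φ) : ℝ × ℝ → ℂ)
      = fun p => cut p.2 * timeShift τ φ p := by
    funext p; rw [timeCutoff_apply]
  rcases lt_or_ge p.2 (-1) with hp | hp
  · have h0 : (timeCutoff (timeShift τ φ) : ℝ × ℝ → ℂ) =ᶠ[nhds p] fun _ => (0 : ℂ) := by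
      have : {q : ℝ × ℝ | q.2 < -1} ∈ nhds p :=
        (isOpen_lt continuous_snd continuous_const).mem_nhds hp
      filter_upwards [this] with q hq
      rw [timeCutoff_apply, cut_of_le (le_of_lt hq), zero_mul]
    have h1 : iteratedFDeriv ℝ n (timeCutoff (timeShift τ φ)) p = 0 := by
      rw [h0.iteratedFDeriv ℝ n |>.eq_of_nhds]
      simp
    rw [h1, norm_zero, mul_zero, mul_zero]
    positivity
  · set q := p + ((0 : ℝ), τ) with hq
    have hq2 : q.2 = p.2 + τ := by simp [hq]
    have hq1 : q.1 = p.1 := by simp [hq]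
    have n1 : |q.1| ≤ ‖q‖ := norm_fst_le q
    have n2 : |q.2| ≤ ‖q‖ := norm_snd_le q
    have hpq : 1 + ‖p‖ ≤ 2 * (1 + ‖q‖) := by
      have : ‖p‖ ≤ 1 + ‖q‖ := by
        rw [Prod.norm_def]
        refine max_le ?_ ?_
        · rw [Real.norm_eq_abs, ← hq1]; linarith
        · rw [Real.norm_eq_abs, abs_le]
          have := le_abs_self q.2
          constructor <;> linarith [norm_nonneg q]
      linarith [norm_nonneg q]
    have hτq : 1 + |τ| ≤ 2 * (1 + ‖q‖) := by
      have : |τ| ≤ 1 + ‖q‖ := by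
        rw [abs_le]
        have := le_abs_self q.2
        constructor <;> linarith [norm_nonneg q]
      linarith [norm_nonneg q]
    have hφ : ∀ j ≤ n, (1 + ‖q‖) ^ K * ‖iteratedFDeriv ℝ j φ q‖ ≤ 2 ^ K * S := fun j hj =>
      SchwartzMap.one_add_le_sup_seminorm_apply (𝕜 := ℂ) (m := (K, n)) le_rfl hj φ q
    rw [hfun]
    have leib := norm_iteratedFDeriv_mul_le (N := ∞) cut_snd_hasTemperateGrowth.1
      (timeShift τ φ).smooth' p (n := n) (by exact_mod_cast le_top)
    have hw : (1 + |τ|) ^ l * (‖p‖ ^ k * (1 + ‖p‖) ^ k₁) ≤ 2 ^ K * (1 + ‖q‖) ^ K := by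
      calc (1 + |τ|) ^ l * (‖p‖ ^ k * (1 + ‖p‖) ^ k₁)
          ≤ (2 * (1 + ‖q‖)) ^ l * ((2 * (1 + ‖q‖)) ^ k * (2 * (1 + ‖q‖)) ^ k₁) := by
            gcongr
            linarith
        _ = (2 * (1 + ‖q‖)) ^ K := by rw [hK]; ring
        _ = _ := mul_pow _ _ _
    calc (1 + |τ|) ^ l * (‖p‖ ^ k *
          ‖iteratedFDeriv ℝ n (fun p => cut p.2 * timeShift τ φ p) p‖)
        ≤ (1 + |τ|) ^ l * (‖p‖ ^ k * ∑ j ∈ Finset.range (n + 1), (n.choose j : ℝ) *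
            ‖iteratedFDeriv ℝ j (fun p : ℝ × ℝ => cut p.2) p‖ *
            ‖iteratedFDeriv ℝ (n - j) (timeShift τ φ) p‖) := by
          gcongr
          exact leib
      _ ≤ (1 + |τ|) ^ l * (‖p‖ ^ k * ∑ j ∈ Finset.range (n + 1), (n.choose j : ℝ) *
            (C₁ * (1 + ‖p‖) ^ k₁) * ‖iteratedFDeriv ℝ (n - j) φ q‖) := by
          gcongr with j hj
          · exact hcut j (by simpa [Nat.lt_succ_iff] using hj) p
          · rw [iteratedFDeriv_timeShift]
      _ = ∑ j ∈ Finset.range (n + 1), (n.choose j : ℝ) * C₁ *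
            (((1 + |τ|) ^ l * (‖p‖ ^ k * (1 + ‖p‖) ^ k₁)) *
              ‖iteratedFDeriv ℝ (n - j) φ q‖) := by
          rw [Finset.mul_sum, Finset.mul_sum]
          refine Finset.sum_congr rfl fun j _ => ?_
          ring
      _ ≤ ∑ j ∈ Finset.range (n + 1), (n.choose j : ℝ) * C₁ * (2 ^ K * (2 ^ K * S)) := by
          refine Finset.sum_le_sum fun j _ => ?_
          refine mul_le_mul_of_nonneg_left ?_ (by positivity)
          calc _ ≤ (2 ^ K * (1 + ‖q‖) ^ K) * ‖iteratedFDeriv ℝ (n - j) φ q‖ := by gcongr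
            _ = 2 ^ K * ((1 + ‖q‖) ^ K * ‖iteratedFDeriv ℝ (n - j) φ q‖) := by ring
            _ ≤ _ := mul_le_mul_of_nonneg_left (hφ _ (Nat.sub_le _ _)) (by positivity)
      _ = 2 ^ n * C₁ * 2 ^ K * 2 ^ K * S := by
          rw [← Finset.sum_mul, ← Finset.sum_mul]
          have : ∑ j ∈ Finset.range (n + 1), (n.choose j : ℝ) = 2 ^ n := by
            exact_mod_cast Nat.sum_range_choose n
          rw [this]; ring

/-- The function `τ ↦ ⟨w(x,t), φ(x, t + τ)⟩` (with the time cutoff inserted). -/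
def slicePairing (w : 𝓢'(ℝ × ℝ, ℂ)) (φ : 𝓢(ℝ × ℝ, ℂ)) (τ : ℝ) : ℂ :=
  w (timeCutoff (timeShift τ φ))

theorem slicePairing_bound (w : 𝓢'(ℝ × ℝ, ℂ)) (l j : ℕ) :
    ∃ (s : Finset (ℕ × ℕ)) (C : ℝ), 0 ≤ C ∧ ∀ (φ : 𝓢(ℝ × ℝ, ℂ)) (τ : ℝ), -1 ≤ τ →
      (1 + |τ|) ^ l * ‖slicePairing w (dt^[j] φ) τ‖ ≤
        C * s.sup (schwartzSeminormFamily ℂ (ℝ × ℝ) ℂ) φ := by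
  have hq : Continuous ((normSeminorm ℂ ℂ).comp w.toLinearMap) :=
    continuous_norm.comp w.continuous
  obtain ⟨s, C, -, hC⟩ := Seminorm.bound_of_continuous (schwartz_withSeminorms ℂ (ℝ × ℝ) ℂ) _ hq
  choose m D hD0 hD using seminorm_cut_timeShift l
  set L : 𝓢(ℝ × ℝ, ℂ) →ₗ[ℂ] 𝓢(ℝ × ℝ, ℂ) :=
    (lineDerivOpCLM ℂ 𝓢(ℝ × ℝ, ℂ) ((0 : ℝ), (1 : ℝ))).toLinearMap ^ j with hL
  have hLj : ∀ φ, L φ = dt^[j] φ := by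
    intro φ
    rw [hL, Module.End.pow_apply]
    rfl
  have hLc : Continuous L := by
    have h1 : Continuous (dt^[j]) :=
      (lineDerivOpCLM ℂ 𝓢(ℝ × ℝ, ℂ) ((0 : ℝ), (1 : ℝ))).continuous.iterate j
    have h2 : (L : 𝓢(ℝ × ℝ, ℂ) → 𝓢(ℝ × ℝ, ℂ)) = dt^[j] := funext hLj
    rw [h2]; exact h1
  have hLb : Seminorm.IsBounded (schwartzSeminormFamily ℂ (ℝ × ℝ) ℂ)
      (schwartzSeminormFamily ℂ (ℝ × ℝ) ℂ) L := by
    intro i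
    obtain ⟨s', C', -, h⟩ := Seminorm.bound_of_continuous (schwartz_withSeminorms ℂ (ℝ × ℝ) ℂ)
      ((schwartzSeminormFamily ℂ (ℝ × ℝ) ℂ i).comp L)
      (((schwartz_withSeminorms ℂ (ℝ × ℝ) ℂ).continuous_seminorm i).comp hLc)
    exact ⟨s', C', h⟩
  choose B t hB using fun i => Seminorm.isBounded_sup hLb (Finset.Iic (m i))
  refine ⟨s.biUnion t, C * ∑ i ∈ s, D i * B i,
    mul_nonneg C.2 (Finset.sum_nonneg fun i _ => mul_nonneg (hD0 i) (B i).2), fun φ τ hτ => ?_⟩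
  set S := (s.biUnion t).sup (schwartzSeminormFamily ℂ (ℝ × ℝ) ℂ) φ
  set R := timeCutoff (timeShift τ (dt^[j] φ)) with hR
  have h1 : ‖slicePairing w (dt^[j] φ) τ‖
      ≤ C * (s.sup (schwartzSeminormFamily ℂ (ℝ × ℝ) ℂ)) R := hC R
  have h2 : (s.sup (schwartzSeminormFamily ℂ (ℝ × ℝ) ℂ)) R
      ≤ ∑ i ∈ s, schwartzSeminormFamily ℂ (ℝ × ℝ) ℂ i R := by
    have := Seminorm.finset_sup_le_sum (schwartzSeminormFamily ℂ (ℝ × ℝ) ℂ) s R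
    simpa using this
  have h3 : ∀ i ∈ s, (1 + |τ|) ^ l * schwartzSeminormFamily ℂ (ℝ × ℝ) ℂ i R
      ≤ D i * B i * S := by
    intro i hi
    have h4 : (Finset.Iic (m i)).sup (schwartzSeminormFamily ℂ (ℝ × ℝ) ℂ) (L φ)
        ≤ B i * (t i).sup (schwartzSeminormFamily ℂ (ℝ × ℝ) ℂ) φ := hB i φ
    have h5 : (t i).sup (schwartzSeminormFamily ℂ (ℝ × ℝ) ℂ) φ ≤ S :=
      Finset.sup_mono (f := schwartzSeminormFamily ℂ (ℝ × ℝ) ℂ)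
        (Finset.subset_biUnion_of_mem t hi) φ
    calc _ ≤ D i * (Finset.Iic (m i)).sup (schwartzSeminormFamily ℂ (ℝ × ℝ) ℂ) (dt^[j] φ) :=
          hD i _ τ hτ
      _ ≤ D i * (B i * S) := by
          rw [← hLj]
          refine mul_le_mul_of_nonneg_left (h4.trans ?_) (hD0 i)
          exact mul_le_mul_of_nonneg_left h5 (B i).2
      _ = _ := by ring
  calc _ ≤ (1 + |τ|) ^ l * (C * ∑ i ∈ s, schwartzSeminormFamily ℂ (ℝ × ℝ) ℂ i R) := by
        refine mul_le_mul_of_nonneg_left (h1.trans ?_) (by positivity)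
        exact mul_le_mul_of_nonneg_left h2 C.2
    _ = C * ∑ i ∈ s, (1 + |τ|) ^ l * schwartzSeminormFamily ℂ (ℝ × ℝ) ℂ i R := by
        rw [← Finset.mul_sum]; ring
    _ ≤ C * ∑ i ∈ s, D i * B i * S :=
        mul_le_mul_of_nonneg_left (Finset.sum_le_sum h3) C.2
    _ = _ := by rw [← Finset.sum_mul]; ring

theorem iteratedDeriv_slicePairing (w : 𝓢'(ℝ × ℝ, ℂ)) (φ : 𝓢(ℝ × ℝ, ℂ)) (n : ℕ) :
    iteratedDeriv n (slicePairing w φ) = slicePairing w (dt^[n] φ) := by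
  induction n with
  | zero => simp
  | succ n ih =>
    rw [iteratedDeriv_succ, ih, Function.iterate_succ_apply']
    funext τ
    exact (hasDerivAt_timeShift (w.comp timeCutoff) (dt^[n] φ) τ).deriv

theorem slicePairing_contDiff (w : 𝓢'(ℝ × ℝ, ℂ)) (φ : 𝓢(ℝ × ℝ, ℂ)) :
    ContDiff ℝ ∞ (slicePairing w φ) := by
  refine contDiff_of_differentiable_iteratedDeriv fun n _ => ?_
  rw [iteratedDeriv_slicePairing]
  exact fun τ => (hasDerivAt_timeShift (w.comp timeCutoff) (dt^[n] φ) τ).differentiableAt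

/-- The map sending `φ` to the test function `τ ↦ ⟨w(x,t), φ(x, t + τ)⟩` of one variable (cut off to
`τ ≥ -1` and `t ≥ -1`); it is continuous on Schwartz functions. -/
def timePairing (w : 𝓢'(ℝ × ℝ, ℂ)) : 𝓢(ℝ × ℝ, ℂ) →L[ℂ] 𝓢(ℝ, ℂ) :=
  SchwartzMap.mkCLM (fun φ τ => cut τ * slicePairing w φ τ)
    (fun φ ψ τ => by simp [slicePairing, mul_add])
    (fun a φ τ => by simp [slicePairing]; ring)
    (fun φ => cut_contDiff.mul (slicePairing_contDiff w φ))
    (by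
      rintro ⟨k, n⟩
      obtain ⟨k₁, C₁, hC₁, hcut⟩ := cut_hasTemperateGrowth.norm_iteratedFDeriv_le_uniform n
      choose s C hC0 hC using slicePairing_bound w (k + k₁)
      refine ⟨(Finset.range (n + 1)).biUnion s,
        ∑ j ∈ Finset.range (n + 1), (n.choose j : ℝ) * C₁ * C (n - j),
        Finset.sum_nonneg fun j _ => mul_nonneg (by positivity) (hC0 _), fun φ τ => ?_⟩
      set S := ((Finset.range (n + 1)).biUnion s).sup (schwartzSeminormFamily ℂ (ℝ × ℝ) ℂ) φ
      have hS0 : 0 ≤ S := apply_nonneg _ _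
      rcases lt_or_ge τ (-1) with hτ | hτ
      · have h0 : (fun τ => cut τ * slicePairing w φ τ) =ᶠ[nhds τ] fun _ => (0 : ℂ) := by
          filter_upwards [Iio_mem_nhds hτ] with y hy
          rw [cut_of_le (le_of_lt hy), zero_mul]
        have h1 : iteratedFDeriv ℝ n (fun τ => cut τ * slicePairing w φ τ) τ = 0 := by
          rw [h0.iteratedFDeriv ℝ n |>.eq_of_nhds]
          simp
        rw [h1, norm_zero, mul_zero]
        exact mul_nonneg (Finset.sum_nonneg fun j _ => mul_nonneg (by positivity) (hC0 _)) hS0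
      · have leib := norm_iteratedFDeriv_mul_le (N := ∞) cut_contDiff
          (slicePairing_contDiff w φ) τ (n := n) (by exact_mod_cast le_top)
        calc _ ≤ ‖τ‖ ^ k * ∑ j ∈ Finset.range (n + 1), (n.choose j : ℝ) *
              ‖iteratedFDeriv ℝ j cut τ‖ * ‖iteratedFDeriv ℝ (n - j) (slicePairing w φ) τ‖ :=
              mul_le_mul_of_nonneg_left leib (by positivity)
          _ = ∑ j ∈ Finset.range (n + 1), (n.choose j : ℝ) * (‖τ‖ ^ k *
              ‖iteratedFDeriv ℝ j cut τ‖ * ‖slicePairing w (dt^[n - j] φ) τ‖) := by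
              rw [Finset.mul_sum]
              refine Finset.sum_congr rfl fun j _ => ?_
              rw [norm_iteratedFDeriv_eq_norm_iteratedDeriv (n := n - j),
                iteratedDeriv_slicePairing]
              ring
          _ ≤ ∑ j ∈ Finset.range (n + 1), (n.choose j : ℝ) * C₁ * C (n - j) * S := by
              refine Finset.sum_le_sum fun j hj => ?_
              have h2 := hC (n - j) φ τ hτ
              have h3 : (s (n - j)).sup (schwartzSeminormFamily ℂ (ℝ × ℝ) ℂ) φ ≤ S :=
                Finset.sup_mono (f := schwartzSeminormFamily ℂ (ℝ × ℝ) ℂ)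
                  (Finset.subset_biUnion_of_mem s (by simp)) φ
              have h4 : ‖iteratedFDeriv ℝ j cut τ‖ ≤ C₁ * (1 + |τ|) ^ k₁ :=
                hcut j (by simpa [Nat.lt_succ_iff] using hj) τ
              have h5 : ‖τ‖ ^ k ≤ (1 + |τ|) ^ k := by
                gcongr; rw [Real.norm_eq_abs]; linarith
              calc _ ≤ (n.choose j : ℝ) * ((1 + |τ|) ^ k * (C₁ * (1 + |τ|) ^ k₁) *
                    ‖slicePairing w (dt^[n - j] φ) τ‖) :=
                  mul_le_mul_of_nonneg_left (mul_le_mul_of_nonneg_right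
                    (mul_le_mul h5 h4 (norm_nonneg _) (by positivity)) (norm_nonneg _))
                    (by positivity)
                _ = (n.choose j : ℝ) * (C₁ *
                    ((1 + |τ|) ^ (k + k₁) * ‖slicePairing w (dt^[n - j] φ) τ‖)) := by ring
                _ ≤ (n.choose j : ℝ) * (C₁ * (C (n - j) * S)) := by
                  refine mul_le_mul_of_nonneg_left ?_ (by positivity)
                  refine mul_le_mul_of_nonneg_left (h2.trans ?_) hC₁
                  exact mul_le_mul_of_nonneg_left h3 (hC0 _)
                _ = _ := by ring
          _ = _ := by rw [Finset.sum_mul])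

theorem timePairing_apply (w : 𝓢'(ℝ × ℝ, ℂ)) (φ : 𝓢(ℝ × ℝ, ℂ)) (τ : ℝ) :
    timePairing w φ τ = cut τ * w (timeCutoff (timeShift τ φ)) := rfl

/-- Convolution in time `Λ *ₜ w` of `Λ ∈ S'₊(ℝ)` with `w ∈ S'(ℝ × ℝ₊)`:
`⟨Λ *ₜ w, φ⟩ = ⟨Λ(τ), ⟨w(x,t), φ(x, t + τ)⟩⟩`. -/
def timeConv (Λ : 𝓢'(ℝ, ℂ)) (w : 𝓢'(ℝ × ℝ, ℂ)) : 𝓢'(ℝ × ℝ, ℂ) :=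
  PointwiseConvergenceCLM.precomp ℂ (timePairing w) Λ

theorem timeConv_apply (Λ : 𝓢'(ℝ, ℂ)) (w : 𝓢'(ℝ × ℝ, ℂ)) (φ : 𝓢(ℝ × ℝ, ℂ)) :
    timeConv Λ w φ = Λ (timePairing w φ) := rfl


theorem bddAbove_pow_mul_exp (k : ℕ) {a : ℝ} (ha : 0 < a) :
    ∃ C : ℝ, 0 ≤ C ∧ ∀ t : ℝ, -1 ≤ t → (1 + |t|) ^ k * Real.exp (-a * t) ≤ C := by
  have hb : ContinuousOn (fun t : ℝ => (1 + |t|) ^ k * Real.exp (-a * t)) (Set.Ici (-1)) := by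
    fun_prop
  have hlim : Filter.Tendsto (fun t : ℝ => (1 + |t|) ^ k * Real.exp (-a * t)) Filter.atTop
      (nhds 0) := by
    have h1 := (Real.tendsto_pow_mul_exp_neg_atTop_nhds_zero k).comp
      (Filter.tendsto_id.const_mul_atTop ha |>.comp
        (Filter.tendsto_atTop_add_const_left Filter.atTop (1 : ℝ) Filter.tendsto_id))
    have h2 := h1.const_mul (Real.exp a / a ^ k)
    rw [mul_zero] at h2
    refine h2.congr' ?_
    filter_upwards [Filter.eventually_ge_atTop (0 : ℝ)] with t ht
    simp only [Function.comp_apply, id, abs_of_nonneg ht, mul_pow]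
    rw [show -(a * (1 + t)) = -a + -a * t by ring, Real.exp_add, Real.exp_neg]
    have : Real.exp a ≠ 0 := Real.exp_ne_zero _
    field_simp
  obtain ⟨N, hN⟩ := Filter.eventually_atTop.1 (hlim.eventually (gt_mem_nhds zero_lt_one))
  obtain ⟨C, hC⟩ := (isCompact_Icc (a := (-1 : ℝ)) (b := N)).exists_bound_of_continuousOn
    (hb.mono fun t ht => ht.1)
  refine ⟨max C 1, le_max_of_le_right zero_le_one, fun t ht => ?_⟩
  rcases le_total t N with h | h
  · exact le_max_of_le_left ((le_abs_self _).trans (hC t ⟨ht, h⟩))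
  · exact le_max_of_le_right (hN t h).le

theorem iteratedDeriv_cexp (s : ℂ) (n : ℕ) :
    iteratedDeriv n (fun t : ℝ => Complex.exp (-s * t)) = fun t : ℝ => (-s) ^ n * Complex.exp (-s * t) := by
  induction n with
  | zero => simp
  | succ n ih =>
    rw [iteratedDeriv_succ, ih]
    funext t
    have h1 : HasDerivAt (fun t : ℝ => -s * (t : ℂ)) (-s * 1) t :=
      (Complex.ofRealCLM.hasDerivAt (x := t)).const_mul (-s)
    have h2 := (h1.cexp.const_mul ((-s) ^ n)).deriv
    rw [h2]; ring

/-- The Schwartz function that equals `e^{-st}` for `t ≥ -1/2` and `0` for `t ≤ -1`. -/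
def expTest (s : ℂ) (hs : 0 < s.re) : 𝓢(ℝ, ℂ) where
  toFun t := cut t * Complex.exp (-s * t)
  smooth' := cut_contDiff.mul (by
    have : ContDiff ℝ ∞ (fun t : ℝ => (t : ℂ)) := Complex.ofRealCLM.contDiff
    exact (contDiff_const.mul this).cexp)
  decay' := by
    intro k n
    have hexp : ContDiff ℝ ∞ (fun t : ℝ => Complex.exp (-s * t)) := by
      have : ContDiff ℝ ∞ (fun t : ℝ => (t : ℂ)) := Complex.ofRealCLM.contDiff
      exact (contDiff_const.mul this).cexp
    obtain ⟨k₁, C₁, hC₁, hcut⟩ := cut_hasTemperateGrowth.norm_iteratedFDeriv_le_uniform n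
    obtain ⟨A, hA0, hA⟩ := bddAbove_pow_mul_exp (k + k₁) hs
    refine ⟨∑ j ∈ Finset.range (n + 1), (n.choose j : ℝ) * (C₁ * ‖s‖ ^ (n - j) * A),
      fun τ => ?_⟩
    rcases lt_or_ge τ (-1) with hτ | hτ
    · have h0 : (fun τ : ℝ => cut τ * Complex.exp (-s * τ)) =ᶠ[nhds τ] fun _ => (0 : ℂ) := by
        filter_upwards [Iio_mem_nhds hτ] with y hy
        rw [cut_of_le (le_of_lt hy), zero_mul]
      have h1 : iteratedFDeriv ℝ n (fun τ : ℝ => cut τ * Complex.exp (-s * τ)) τ = 0 := by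
        rw [h0.iteratedFDeriv ℝ n |>.eq_of_nhds]
        simp
      rw [h1, norm_zero, mul_zero]
      exact Finset.sum_nonneg fun j _ => by positivity
    · have leib := norm_iteratedFDeriv_mul_le (N := ∞) cut_contDiff hexp τ (n := n)
        (by exact_mod_cast le_top)
      calc _ ≤ ‖τ‖ ^ k * ∑ j ∈ Finset.range (n + 1), (n.choose j : ℝ) *
              ‖iteratedFDeriv ℝ j cut τ‖ *
              ‖iteratedFDeriv ℝ (n - j) (fun t : ℝ => Complex.exp (-s * t)) τ‖ :=
            mul_le_mul_of_nonneg_left leib (by positivity)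
        _ ≤ _ := by
          rw [Finset.mul_sum]
          refine Finset.sum_le_sum fun j hj => ?_
          have h4 : ‖iteratedFDeriv ℝ j cut τ‖ ≤ C₁ * (1 + |τ|) ^ k₁ :=
            hcut j (by simpa [Nat.lt_succ_iff] using hj) τ
          have h5 : ‖τ‖ ^ k ≤ (1 + |τ|) ^ k := by
            gcongr; rw [Real.norm_eq_abs]; linarith
          have h6 : ‖iteratedFDeriv ℝ (n - j) (fun t : ℝ => Complex.exp (-s * t)) τ‖
              = ‖s‖ ^ (n - j) * Real.exp (-s.re * τ) := by
            rw [norm_iteratedFDeriv_eq_norm_iteratedDeriv, iteratedDeriv_cexp, norm_mul, norm_pow,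
              norm_neg, Complex.norm_exp]
            simp
          rw [h6]
          calc _ = (n.choose j : ℝ) * ((‖τ‖ ^ k * ‖iteratedFDeriv ℝ j cut τ‖) *
                (‖s‖ ^ (n - j) * Real.exp (-s.re * τ))) := by ring
            _ ≤ (n.choose j : ℝ) * (((1 + |τ|) ^ k * (C₁ * (1 + |τ|) ^ k₁)) *
                (‖s‖ ^ (n - j) * Real.exp (-s.re * τ))) := by
              refine mul_le_mul_of_nonneg_left ?_ (by positivity)
              exact mul_le_mul_of_nonneg_right
                (mul_le_mul h5 h4 (norm_nonneg _) (by positivity)) (by positivity)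
            _ = (n.choose j : ℝ) * (C₁ * ‖s‖ ^ (n - j) *
                ((1 + |τ|) ^ (k + k₁) * Real.exp (-s.re * τ))) := by ring
            _ ≤ _ := by
              refine mul_le_mul_of_nonneg_left ?_ (by positivity)
              exact mul_le_mul_of_nonneg_left (hA τ hτ) (by positivity)

/-- Laplace transform `⟨Λ(t), e^{-st}⟩` of `Λ ∈ S'₊(ℝ)` on the half-plane `Re s > 0`. -/
def laplace (Λ : 𝓢'(ℝ, ℂ)) (s : ℂ) (hs : 0 < s.re) : ℂ := Λ (expTest s hs)

/-- The measure `t^{β-1}/Γ(β) dt` on `(0, ∞)`. -/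
def powerMeasure (β : ℝ) : Measure ℝ :=
  (volume.restrict (Set.Ioi 0)).withDensity
    (fun t => ENNReal.ofReal (t ^ (β - 1) / Real.Gamma β))

theorem powerMeasure_hasTemperateGrowth {β : ℝ} (hβ : 0 < β) :
    (powerMeasure β).HasTemperateGrowth := by
  obtain ⟨n, hn⟩ := exists_nat_gt β
  refine ⟨n, ?_⟩
  have hm : Measurable fun t : ℝ => t ^ (β - 1) / Real.Gamma β := by fun_prop
  rw [powerMeasure, integrable_withDensity_iff_integrable_smul' (by fun_prop)
    (Filter.Eventually.of_forall fun _ => ENNReal.ofReal_lt_top)]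
  have hG : 0 < Real.Gamma β := Real.Gamma_pos_of_pos hβ
  have h1 : IntegrableOn (fun t : ℝ => t ^ (β - 1)) (Set.Ioc 0 1) := by
    have := intervalIntegral.intervalIntegrable_rpow' (a := 0) (b := 1)
      (show -1 < β - 1 by linarith)
    rwa [intervalIntegrable_iff_integrableOn_Ioc_of_le zero_le_one] at this
  have h2 : IntegrableOn (fun t : ℝ => t ^ (β - 1 - n)) (Set.Ioi 1) :=
    integrableOn_Ioi_rpow_of_lt (by linarith) one_pos
  have hmeas : AEStronglyMeasurable (fun t : ℝ => t ^ (β - 1) * (1 + ‖t‖) ^ (-(n : ℝ)))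
      (volume.restrict (Set.Ioi 0)) := by
    apply Measurable.aestronglyMeasurable
    fun_prop
  have h3 : IntegrableOn (fun t : ℝ => t ^ (β - 1) * (1 + ‖t‖) ^ (-(n : ℝ))) (Set.Ioi 0) := by
    rw [← Set.Ioc_union_Ioi_eq_Ioi zero_le_one]
    refine IntegrableOn.union ?_ ?_
    · refine Integrable.mono' h1 (hmeas.mono_set Set.Ioc_subset_Ioi_self) ?_
      filter_upwards [ae_restrict_mem measurableSet_Ioc] with t ht
      have h0 : 0 ≤ t ^ (β - 1) := Real.rpow_nonneg ht.1.le _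
      rw [norm_mul, Real.norm_of_nonneg h0, Real.norm_of_nonneg (by positivity)]
      refine mul_le_of_le_one_right h0 ?_
      exact Real.rpow_le_one_of_one_le_of_nonpos (by linarith [norm_nonneg t]) (by simp)
    · refine Integrable.mono' h2
        (hmeas.mono_set (Set.Ioi_subset_Ioi zero_le_one)) ?_
      filter_upwards [ae_restrict_mem measurableSet_Ioi] with t ht
      have ht0 : (0 : ℝ) < t := zero_lt_one.trans ht
      have h0 : 0 ≤ t ^ (β - 1) := Real.rpow_nonneg ht0.le _
      rw [norm_mul, Real.norm_of_nonneg h0, Real.norm_of_nonneg (by positivity),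
        sub_eq_add_neg (β - 1), Real.rpow_add ht0]
      refine mul_le_mul_of_nonneg_left ?_ h0
      refine Real.rpow_le_rpow_of_nonpos ht0 ?_ (by simp)
      rw [Real.norm_of_nonneg ht0.le]; linarith
  refine (h3.const_mul (1 / Real.Gamma β)).congr ?_
  filter_upwards [ae_restrict_mem measurableSet_Ioi] with t ht
  have h0 : 0 ≤ t ^ (β - 1) / Real.Gamma β :=
    div_nonneg (Real.rpow_nonneg (le_of_lt ht) _) hG.le
  rw [ENNReal.toReal_ofReal h0, smul_eq_mul]
  ring

/-- The distribution `f_β(t) = H(t) t^{β-1}/Γ(β)` for `β > 0`. -/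
def kernelPos (β : ℝ) (hβ : 0 < β) : 𝓢'(ℝ, ℂ) :=
  haveI := powerMeasure_hasTemperateGrowth hβ
  (powerMeasure β).toTemperedDistribution

/-- The family `f_β ∈ S'₊(ℝ)`, `β ∈ ℝ`: `H(t) t^{β-1}/Γ(β)` for `β > 0`, and the `N`-th distributional
derivative of `f_{β+N}` for `β ≤ 0`, with `N` the least natural number such that `β + N > 0`. -/
def kernel (β : ℝ) : 𝓢'(ℝ, ℂ) :=
  if hβ : 0 < β then kernelPos β hβ
  else (TemperedDistribution.derivCLM ℂ)^[⌊-β⌋₊ + 1]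
    (kernelPos (β + (⌊-β⌋₊ + 1 : ℕ)) (by
      push_cast
      linarith [Nat.lt_floor_add_one (-β)]))

/-- A smooth compactly supported function equal to `1` on `[-1/2, 3/2]`. -/
def pairingCutoff : ContDiffBump (1 / 2 : ℝ) := ⟨1, 2, one_pos, one_lt_two⟩

/-- A smooth function on `ℝ`, multiplied by the cutoff that is `1` on a neighbourhood of `[0, 1]`. -/
def cutTest (f : ℝ → ℝ) (hf : ContDiff ℝ ∞ f) : 𝓓((⊤ : Opens ℝ), ℝ) where
  toFun α := pairingCutoff α * f α
  contDiff' := pairingCutoff.contDiff.mul hf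
  hasCompactSupport' := pairingCutoff.hasCompactSupport.mul_right
  tsupport_subset' := by simp

open scoped Classical in
/-- The pairing `⟨ϕ(α), f(α)⟩` of a distribution `ϕ` with support in `[0, 1]` with a smooth complex valued
function `f` on `ℝ` (not necessarily compactly supported); such a `ϕ` does not see the cutoff. -/
def pairing (ϕ : 𝓓'((⊤ : Opens ℝ), ℂ)) (f : ℝ → ℂ) : ℂ :=
  if hf : ContDiff ℝ ∞ f then
    ϕ (cutTest (fun α => (f α).re) (Complex.reCLM.contDiff.comp hf)) +
      Complex.I * ϕ (cutTest (fun α => (f α).im) (Complex.imCLM.contDiff.comp hf))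
  else 0

/-- The function `Φ(s) = ⟨ϕ(α), s^α⟩`, `Re s > 0` (principal branch of the power). -/
def symbol (ϕ : 𝓓'((⊤ : Opens ℝ), ℂ)) (s : ℂ) : ℂ :=
  pairing ϕ (fun α => s ^ (α : ℂ))

/-- `Λ = L⁻¹(Y / Z)` in `S'₊(ℝ)`: `Λ` is a tempered distribution supported in `[0, ∞)`, the
denominator `Z` does not vanish identically on `Re s > 0`, and the Laplace transform of `Λ` is the
quotient `Y / Z` wherever on `Re s > 0` the denominator is nonzero. -/
structure IsInverseLaplaceQuotient (Y Z : ℂ → ℂ) (Λ : 𝓢'(ℝ, ℂ)) : Prop where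
  causal : Distribution.IsVanishingOn Λ (Set.Iio (0 : ℝ))
  denom_ne_zero : ∃ s : ℂ, 0 < s.re ∧ Z s ≠ 0
  laplace_eq : ∀ (s : ℂ) (hs : 0 < s.re), Z s ≠ 0 → laplace Λ s hs = Y s / Z s

/-- Membership in `S'(ℝ × ℝ₊)`: a tempered distribution on `ℝ²` that vanishes for `t < 0`. -/
def IsCausal (w : 𝓢'(ℝ × ℝ, ℂ)) : Prop :=
  Distribution.IsVanishingOn w {p : ℝ × ℝ | p.2 < 0}

/-- Equality for `t > 0`: the difference vanishes on the open half-plane `t > 0`. -/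
def EqForPositiveTime (v w : 𝓢'(ℝ × ℝ, ℂ)) : Prop :=
  Distribution.IsVanishingOn (v - w) {p : ℝ × ℝ | 0 < p.2}

/-- Distributional derivative `∂/∂x`. -/
def partialX (w : 𝓢'(ℝ × ℝ, ℂ)) : 𝓢'(ℝ × ℝ, ℂ) := ∂_{((1 : ℝ), (0 : ℝ))} w

/-- Distributional derivative `∂/∂t`. -/
def partialT (w : 𝓢'(ℝ × ℝ, ℂ)) : 𝓢'(ℝ × ℝ, ℂ) := ∂_{((0 : ℝ), (1 : ℝ))} w

/-- The Riemann-Liouville derivative `₀D_t^α y = f_{-α} *ₜ y` in the distributional setting. -/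
def fracDeriv (α : ℝ) (y : 𝓢'(ℝ × ℝ, ℂ)) : 𝓢'(ℝ × ℝ, ℂ) := timeConv (kernel (-α)) y

/-- The distributed order fractional derivative `∫ ϕ(α) ₀D_t^α y dα`, as a functional on test
functions: `φ ↦ ⟨ϕ(α), ⟨₀D_t^α y, φ⟩⟩`. -/
def distOrderDeriv (ϕ : 𝓓'((⊤ : Opens ℝ), ℂ)) (y : 𝓢'(ℝ × ℝ, ℂ)) (φ : 𝓢(ℝ × ℝ, ℂ)) : ℂ :=
  pairing ϕ (fun α => fracDeriv α y φ)

/-- The constitutive law `∫ ϕσ(α) ₀D_t^α σ dα = ∫ ϕε(α) ₀D_t^α ε dα`. -/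
def ConstitutiveLaw (ϕσ ϕε : 𝓓'((⊤ : Opens ℝ), ℂ)) (σ ε : 𝓢'(ℝ × ℝ, ℂ)) : Prop :=
  ∀ φ : 𝓢(ℝ × ℝ, ℂ), distOrderDeriv ϕσ σ φ = distOrderDeriv ϕε ε φ

/-- Restriction of a test function to the line `t = 0`. -/
def restrictZero : 𝓢(ℝ × ℝ, ℂ) →L[ℂ] 𝓢(ℝ, ℂ) :=
  SchwartzMap.compCLMOfAntilipschitz (K := 1) ℂ (g := fun x : ℝ => (x, (0 : ℝ)))
    (ContinuousLinearMap.inl ℝ ℝ ℝ).hasTemperateGrowth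
    (AntilipschitzWith.of_le_mul_dist fun x y => by simp [Prod.dist_eq])

/-- The distribution `a(x) δ(t)`. -/
def tensorDelta (a : 𝓢'(ℝ, ℂ)) : 𝓢'(ℝ × ℝ, ℂ) :=
  PointwiseConvergenceCLM.precomp ℂ restrictZero a

/-- The source `u₀(x) δ'(t) + v₀(x) δ(t)` carrying the initial displacement and velocity. -/
def initialSource (u₀ v₀ : 𝓢'(ℝ, ℂ)) : 𝓢'(ℝ × ℝ, ℂ) :=
  partialT (tensorDelta u₀) + tensorDelta v₀

/-- The system: equation of motion for `t > 0`, constitutive law, strain. -/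
structure IsSystemSolution (ϕσ ϕε : 𝓓'((⊤ : Opens ℝ), ℂ)) (u σ ε : 𝓢'(ℝ × ℝ, ℂ)) : Prop where
  motion : EqForPositiveTime (partialX σ) (partialT (partialT u))
  constitutive : ConstitutiveLaw ϕσ ϕε σ ε
  strain : ε = partialX u

/-- The wave equation `u_tt - Λ *ₜ u_xx = 0` for `t > 0`. -/
def IsWaveSolution (Λ : 𝓢'(ℝ, ℂ)) (u : 𝓢'(ℝ × ℝ, ℂ)) : Prop :=
  EqForPositiveTime (partialT (partialT u) - timeConv Λ (partialX (partialX u))) 0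

/-- The system with initial data `u₀, v₀` built into the equation of motion as a source at `t = 0`,
the equation of motion now being an equality of distributions on the whole plane. -/
structure IsCauchySystemSolution (ϕσ ϕε : 𝓓'((⊤ : Opens ℝ), ℂ)) (u₀ v₀ : 𝓢'(ℝ, ℂ))
    (u σ ε : 𝓢'(ℝ × ℝ, ℂ)) : Prop where
  motion : partialX σ + initialSource u₀ v₀ = partialT (partialT u)
  constitutive : ConstitutiveLaw ϕσ ϕε σ ε
  strain : ε = partialX u

/-- The generalized Cauchy problem `u_tt - Λ *ₜ u_xx = u₀(x) δ'(t) + v₀(x) δ(t)`. -/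
def IsCauchyWaveSolution (Λ : 𝓢'(ℝ, ℂ)) (u₀ v₀ : 𝓢'(ℝ, ℂ)) (u : 𝓢'(ℝ × ℝ, ℂ)) : Prop :=
  partialT (partialT u) - timeConv Λ (partialX (partialX u)) = initialSource u₀ v₀

end

end FracWave

open FracWave

/-! The content is `constitutiveLaw_iff`: for causal σ and ε the constitutive law amounts to σ = Λ
*ₜ ε. Since `partialX` commutes with convolution in time, the rest is substitution, both for the
problem on t > 0 and for the one with initial data.

The law is first turned into an equation between two convolutions. For fixed ψ the function α ↦
⟨f_{-α}, ψ⟩ is the restriction of a holomorphic function, and Cauchy's estimates bound its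
derivatives near [0, 1] by finitely many Schwartz seminorms of ψ. Hence ∫ ϕ(α) f_{-α} dα is a
tempered distribution `symbolDist ϕ`, causal, with Laplace transform Φ(s) (`laplace_symbolDist`),
and the law reads F_σ *ₜ σ = F_ε *ₜ ε, where F_σ and F_ε are the `symbolDist` of ϕσ and ϕε.

Such equations are solved by a scalar Laplace transform. For causal w and a test function φ
vanishing for large t, let `sliceTransform w φ s` be ∫ e^{sτ} ⟨w, φ(x, t + τ)⟩ dτ, Re s > 0.
Formally it is the Laplace transform of w in t, paired with the two-sided transform of φ.
Convolution with F multiplies it by the Laplace transform of F (`sliceTransform_timeConv`). It is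
holomorphic in s, and its values near one point, for all such φ, determine w
(`eq_of_sliceTransform`). Therefore Φσ only has to be nonzero near a single point: there one divides
by Φσ in one direction and multiplies by it in the other. No associativity of convolution is needed.
-/

namespace FracWave

noncomputable section

open scoped ContDiff Topology
open LineDeriv MeasureTheory TopologicalSpace

/-! ### Continuity estimates for functionals on products of Schwartz functions with multipliers -/

section Seminorms

variable {E : Type*} [NormedAddCommGroup E] [NormedSpace ℝ E]

theorem exists_norm_le_sum_seminorm (W : 𝓢(E, ℂ) →L[ℂ] ℂ) :
    ∃ (n : ℕ) (C : ℝ), 0 ≤ C ∧ ∀ ψ : 𝓢(E, ℂ),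
      ‖W ψ‖ ≤ C * ∑ i ∈ Finset.Iic (n, n), SchwartzMap.seminorm ℂ i.1 i.2 ψ := by
  have hq : Continuous ((normSeminorm ℂ ℂ).comp W.toLinearMap) :=
    continuous_norm.comp W.continuous
  obtain ⟨s, C, -, hC⟩ := Seminorm.bound_of_continuous (schwartz_withSeminorms ℂ E ℂ) _ hq
  obtain ⟨n, hn⟩ : ∃ n : ℕ, s ⊆ Finset.Iic (n, n) := by
    refine ⟨s.sup Prod.fst + s.sup Prod.snd, fun i hi => ?_⟩
    have h1 : i.1 ≤ s.sup Prod.fst := Finset.le_sup (f := Prod.fst) hi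
    have h2 : i.2 ≤ s.sup Prod.snd := Finset.le_sup (f := Prod.snd) hi
    rw [Finset.mem_Iic, Prod.le_def]
    constructor <;> dsimp only <;> omega
  refine ⟨n, C, C.2, fun ψ => ?_⟩
  have h1 : ‖W ψ‖ ≤ C * (s.sup (schwartzSeminormFamily ℂ E ℂ)) ψ := hC ψ
  refine h1.trans (mul_le_mul_of_nonneg_left ?_ C.2)
  have h2 := Seminorm.finset_sup_le_sum (schwartzSeminormFamily ℂ E ℂ) s ψ
  have h3 : (s.sup (schwartzSeminormFamily ℂ E ℂ)) ψ
      ≤ ∑ i ∈ s, schwartzSeminormFamily ℂ E ℂ i ψ := by simpa using h2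
  exact h3.trans (Finset.sum_le_sum_of_subset_of_nonneg hn fun i _ _ => apply_nonneg _ _)

/-- By Leibniz, the decay of `M` absorbs the growth of the multiplier at the price of `m` more
weights. The constant depends on `M` but not on `f`, so a family of multipliers tending to 0 in
these weighted norms gives products tending to 0. -/
theorem seminorm_smulLeft_le (M : 𝓢(E, ℂ)) (k n m : ℕ) :
    ∃ C : ℝ, 0 ≤ C ∧ ∀ (f : E → ℂ), f.HasTemperateGrowth → ∀ B : ℝ, 0 ≤ B →
      (∀ j ≤ n, ∀ p, ‖iteratedFDeriv ℝ j f p‖ ≤ B * (1 + ‖p‖) ^ m) →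
      SchwartzMap.seminorm ℂ k n (SchwartzMap.smulLeftCLM ℂ f M) ≤ C * B := by
  set S := 2 ^ (k + m) * (Finset.Iic (k + m, n)).sup (fun i => SchwartzMap.seminorm ℂ i.1 i.2) M
    with hS
  have hS0 : 0 ≤ S := by positivity
  refine ⟨2 ^ n * S, by positivity, fun f hf B hB h => ?_⟩
  refine SchwartzMap.seminorm_le_bound ℂ k n _ (by positivity) fun p => ?_
  have hfun : (SchwartzMap.smulLeftCLM ℂ f M : E → ℂ) = fun p => f p * M p := by
    funext p; rw [SchwartzMap.smulLeftCLM_apply_apply hf, smul_eq_mul]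
  rw [hfun]
  have leib := norm_iteratedFDeriv_mul_le (N := ∞) hf.1 M.smooth' p (n := n)
    (by exact_mod_cast le_top)
  calc ‖p‖ ^ k * ‖iteratedFDeriv ℝ n (fun p => f p * M p) p‖
      ≤ (1 + ‖p‖) ^ k * ∑ j ∈ Finset.range (n + 1), (n.choose j : ℝ) *
          ‖iteratedFDeriv ℝ j f p‖ * ‖iteratedFDeriv ℝ (n - j) M p‖ := by
        gcongr
        · linarith
        · exact leib
    _ ≤ (1 + ‖p‖) ^ k * ∑ j ∈ Finset.range (n + 1), (n.choose j : ℝ) *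
          (B * (1 + ‖p‖) ^ m) * ‖iteratedFDeriv ℝ (n - j) M p‖ := by
        gcongr with j hj
        exact h j (by simpa [Nat.lt_succ_iff] using hj) p
    _ = ∑ j ∈ Finset.range (n + 1), (n.choose j : ℝ) *
          (B * ((1 + ‖p‖) ^ (k + m) * ‖iteratedFDeriv ℝ (n - j) M p‖)) := by
        rw [Finset.mul_sum]
        refine Finset.sum_congr rfl fun j _ => ?_
        ring
    _ ≤ ∑ j ∈ Finset.range (n + 1), (n.choose j : ℝ) * (B * S) := by
        gcongr with j hj
        exact SchwartzMap.one_add_le_sup_seminorm_apply (𝕜 := ℂ) (m := (k + m, n)) le_rfl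
          (Nat.sub_le _ _) M p
    _ = 2 ^ n * S * B := by
        rw [← Finset.sum_mul]
        have : ∑ j ∈ Finset.range (n + 1), (n.choose j : ℝ) = 2 ^ n := by
          exact_mod_cast Nat.sum_range_choose n
        rw [this]; ring

/-- A continuous functional evaluated at `f M`, with `M` a Schwartz function, is controlled by
weighted sup norms of finitely many derivatives of `f`. -/
theorem norm_apply_smulLeft_le (W : 𝓢(E, ℂ) →L[ℂ] ℂ) :
    ∃ n : ℕ, ∀ (M : 𝓢(E, ℂ)) (m : ℕ), ∃ C : ℝ, 0 ≤ C ∧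
      ∀ (f : E → ℂ), f.HasTemperateGrowth → ∀ B : ℝ, 0 ≤ B →
      (∀ j ≤ n, ∀ p, ‖iteratedFDeriv ℝ j f p‖ ≤ B * (1 + ‖p‖) ^ m) →
      ‖W (SchwartzMap.smulLeftCLM ℂ f M)‖ ≤ C * B := by
  obtain ⟨n, C, hC0, hC⟩ := exists_norm_le_sum_seminorm W
  refine ⟨n, fun M m => ?_⟩
  choose D hD0 hD using fun i : ℕ × ℕ => seminorm_smulLeft_le M i.1 i.2 m
  refine ⟨C * ∑ i ∈ Finset.Iic (n, n), D i,
    mul_nonneg hC0 (Finset.sum_nonneg fun i _ => hD0 i), fun f hf B hB h => ?_⟩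
  refine (hC _).trans ?_
  rw [mul_assoc, Finset.sum_mul]
  refine mul_le_mul_of_nonneg_left (Finset.sum_le_sum fun i hi => ?_) hC0
  exact hD i f hf B hB fun j hj p => h j (hj.trans (Finset.mem_Iic.1 hi).2) p

end Seminorms

/-! ### Dependence of T(M(t) K(t + a)) on the translation a -/

section Translates

variable {K : ℝ → ℂ} {G : 𝓢(ℝ, ℂ)}

theorem iteratedDeriv_primitive (hK : ∀ t, HasDerivAt K (G t) t) (j : ℕ) :
    iteratedDeriv (j + 1) K = iteratedDeriv j G := by
  rw [iteratedDeriv_succ', show deriv K = G from funext fun t => (hK t).deriv]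

theorem contDiff_primitive (hK : ∀ t, HasDerivAt K (G t) t) : ContDiff ℝ ∞ K := by
  rw [contDiff_infty_iff_deriv, show deriv K = G from funext fun t => (hK t).deriv]
  exact ⟨fun t => (hK t).differentiableAt, G.smooth'⟩

theorem primitive_hasTemperateGrowth (hK : ∀ t, HasDerivAt K (G t) t) {C : ℝ}
    (hC : ∀ t, ‖K t‖ ≤ C) : K.HasTemperateGrowth := by
  refine Function.HasTemperateGrowth.of_fderiv (k := 0) (C := C) ?_
    (fun t => (hK t).differentiableAt) (by simpa using hC)
  have : fderiv ℝ K = fun t => ContinuousLinearMap.smulRightL ℝ ℝ ℂ 1 (G t) := by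
    funext t
    rw [(hK t).hasFDerivAt.fderiv]
    ext
    simp
  rw [this]
  exact (ContinuousLinearMap.smulRightL ℝ ℝ ℂ 1).hasTemperateGrowth.comp G.hasTemperateGrowth

theorem hasTemperateGrowth_add_const {f : ℝ → ℂ} (hf : f.HasTemperateGrowth) (a : ℝ) :
    (fun t => f (t + a)).HasTemperateGrowth :=
  hf.comp (by fun_prop)

/-- The function `t ↦ M(t) K(t + a)`. -/
def mulTranslate (M : 𝓢(ℝ, ℂ)) (K : ℝ → ℂ) (a : ℝ) : 𝓢(ℝ, ℂ) :=
  SchwartzMap.smulLeftCLM ℂ (fun t => K (t + a)) M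

/-- The difference quotient acts on the multiplier only. The j-th derivative of its Taylor remainder
is O(h²) uniformly in t, because the second derivative of K^{(j)} is G^{(j+1)}, which is bounded. -/
theorem hasDerivAt_mulTranslate (T : 𝓢(ℝ, ℂ) →L[ℂ] ℂ) (M : 𝓢(ℝ, ℂ))
    (hK : ∀ t, HasDerivAt K (G t) t) (hKt : K.HasTemperateGrowth) (a : ℝ) :
    HasDerivAt (fun a => T (mulTranslate M K a)) (T (mulTranslate M G a)) a := by
  obtain ⟨n, hn⟩ := norm_apply_smulLeft_le T
  obtain ⟨C, hC0, hC⟩ := hn M 0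
  set B : ℝ := ∑ j ∈ Finset.range (n + 1), SchwartzMap.seminorm ℂ 0 (j + 1) G with hB
  have hB0 : 0 ≤ B := Finset.sum_nonneg fun j _ => apply_nonneg _ _
  rw [hasDerivAt_iff_isLittleO_nhds_zero]
  have hb : (fun h : ℝ => T (mulTranslate M K (a + h)) - T (mulTranslate M K a)
      - h • T (mulTranslate M G a)) =O[𝓝 0] fun h : ℝ => h ^ 2 := by
    refine Asymptotics.IsBigO.of_bound (C * B) ?_
    filter_upwards [Icc_mem_nhds (show (-1 : ℝ) < 0 by norm_num) (show (0 : ℝ) < 1 by norm_num)]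
      with h hh
    have hh' : |h| ≤ 1 := abs_le.2 hh
    set f : ℝ → ℂ := fun t => K (t + (a + h)) - K (t + a) - (h : ℂ) * G (t + a) with hf
    have g1 := hasTemperateGrowth_add_const hKt (a + h)
    have g2 := hasTemperateGrowth_add_const hKt a
    have g3 : (fun t => (h : ℂ) * G (t + a)).HasTemperateGrowth :=
      (Function.HasTemperateGrowth.const (h : ℂ)).mul
        (hasTemperateGrowth_add_const G.hasTemperateGrowth a)
    have hft : f.HasTemperateGrowth := (g1.sub g2).sub g3
    have e : T (mulTranslate M K (a + h)) - T (mulTranslate M K a) - h • T (mulTranslate M G a)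
        = T (SchwartzMap.smulLeftCLM ℂ f M) := by
      rw [← map_sub, ← Complex.coe_smul, ← map_smul, ← map_sub]
      congr 1
      ext t
      rw [SchwartzMap.smulLeftCLM_apply_apply hft]
      simp only [mulTranslate, sub_apply, smul_apply,
        SchwartzMap.smulLeftCLM_apply_apply g1, SchwartzMap.smulLeftCLM_apply_apply g2,
        SchwartzMap.smulLeftCLM_apply_apply
          (hasTemperateGrowth_add_const G.hasTemperateGrowth a), hf, smul_eq_mul]
      ring
    rw [e, mul_assoc]
    refine hC f hft (B * ‖h ^ 2‖) (by positivity) fun j hj t => ?_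
    rw [pow_zero, mul_one, norm_iteratedFDeriv_eq_norm_iteratedDeriv]
    have hKd := contDiff_primitive hK
    have hder : ∀ (i : ℕ) (θ : ℝ), HasDerivAt (fun θ => iteratedDeriv i K (t + a + θ))
        (iteratedDeriv (i + 1) K (t + a + θ)) θ := by
      intro i θ
      have h1 : Differentiable ℝ (iteratedDeriv i K) :=
        hKd.differentiable_iteratedDeriv i (by exact_mod_cast WithTop.coe_lt_top _)
      rw [iteratedDeriv_succ]
      exact (h1 _).hasDerivAt.comp_const_add (t + a) θ
    have key := norm_taylor_two (hder j) (hder (j + 1)) (M := B) (fun θ _ => by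
      rw [iteratedDeriv_primitive hK]
      have h1 := SchwartzMap.norm_iteratedFDeriv_le_seminorm ℂ G (j + 1) (t + a + θ)
      rw [norm_iteratedFDeriv_eq_norm_iteratedDeriv] at h1
      refine h1.trans ?_
      exact Finset.single_le_sum (f := fun j => SchwartzMap.seminorm ℂ 0 (j + 1) G)
        (fun j _ => apply_nonneg _ _) (Finset.mem_range.2 (by omega))) hh'
    have e2 : iteratedDeriv j f t = iteratedDeriv j K (t + a + h) - iteratedDeriv j K (t + a + 0)
        - h • iteratedDeriv (j + 1) K (t + a + 0) := by
      have c1 : ContDiffAt ℝ j (fun t => K (t + (a + h))) t :=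
        (g1.1.of_le (by exact_mod_cast le_top)).contDiffAt
      have c2 : ContDiffAt ℝ j (fun t => K (t + a)) t :=
        (g2.1.of_le (by exact_mod_cast le_top)).contDiffAt
      have c4 : ContDiffAt ℝ j (fun t => G (t + a)) t :=
        ((hasTemperateGrowth_add_const G.hasTemperateGrowth a).1.of_le
          (by exact_mod_cast le_top)).contDiffAt
      have c3 : ContDiffAt ℝ j (fun t => (h : ℂ) * G (t + a)) t :=
        (g3.1.of_le (by exact_mod_cast le_top)).contDiffAt
      rw [hf, iteratedDeriv_fun_sub (c1.sub c2) c3, iteratedDeriv_fun_sub c1 c2,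
        iteratedDeriv_const_mul_field, iteratedDeriv_comp_add_const, iteratedDeriv_comp_add_const,
        iteratedDeriv_comp_add_const, iteratedDeriv_primitive hK, Complex.real_smul]
      simp [add_assoc]
    rw [e2, Real.norm_of_nonneg (sq_nonneg h)]
    exact key
  refine hb.trans_isLittleO ?_
  simpa using Asymptotics.isLittleO_pow_id (𝕜 := ℝ) (show 1 < 2 by norm_num)

/-- The multiplier K(t + a) - L and its derivatives are at most B(1 + |t|)/(1 + |a|), and one factor
1 + |t| is harmless against `M`. The function itself is controlled by `hL`; its derivatives are
derivatives of the Schwartz function `G`. -/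
theorem tendsto_mulTranslate (T : 𝓢(ℝ, ℂ) →L[ℂ] ℂ) (M : 𝓢(ℝ, ℂ))
    (hK : ∀ t, HasDerivAt K (G t) t) (hKt : K.HasTemperateGrowth) {l : Filter ℝ}
    (hl : Filter.Tendsto (fun a : ℝ => |a|) l Filter.atTop) {L : ℂ} {C : ℝ}
    (hL : ∀ᶠ a in l, ∀ t, ‖K (t + a) - L‖ * (1 + |a|) ≤ C * (1 + |t|)) :
    Filter.Tendsto (fun a => T (mulTranslate M K a)) l (𝓝 (L * T M)) := by
  obtain ⟨n, hn⟩ := norm_apply_smulLeft_le T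
  obtain ⟨D, hD0, hD⟩ := hn M 1
  set B : ℝ := |C| + ∑ j ∈ Finset.range (n + 1),
    (SchwartzMap.seminorm ℂ 0 j G + SchwartzMap.seminorm ℂ 1 j G) with hB
  have hB0 : 0 ≤ B := add_nonneg (abs_nonneg _)
    (Finset.sum_nonneg fun j _ => add_nonneg (apply_nonneg _ _) (apply_nonneg _ _))
  rw [tendsto_iff_norm_sub_tendsto_zero]
  have hlim : Filter.Tendsto (fun a : ℝ => D * (B / (1 + |a|))) l (𝓝 0) := by
    have h1 : Filter.Tendsto (fun a : ℝ => B / (1 + |a|)) l (𝓝 0) :=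
      tendsto_const_nhds.div_atTop (Filter.tendsto_atTop_add_const_left l 1 hl)
    simpa using h1.const_mul D
  refine squeeze_zero' (Filter.Eventually.of_forall fun a => norm_nonneg _) ?_ hlim
  filter_upwards [hL] with a ha
  set f : ℝ → ℂ := fun t => K (t + a) - L with hf
  have g1 := hasTemperateGrowth_add_const hKt a
  have hft : f.HasTemperateGrowth := g1.sub (Function.HasTemperateGrowth.const L)
  have e : T (mulTranslate M K a) - L * T M = T (SchwartzMap.smulLeftCLM ℂ f M) := by
    rw [← smul_eq_mul, ← map_smul, ← map_sub]
    congr 1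
    ext t
    rw [SchwartzMap.smulLeftCLM_apply_apply hft]
    simp only [mulTranslate, sub_apply, smul_apply,
      SchwartzMap.smulLeftCLM_apply_apply g1, hf, smul_eq_mul]
    ring
  have ha0 : 0 < 1 + |a| := by positivity
  rw [e]
  refine hD f hft _ (by positivity) fun j hj t => ?_
  rw [pow_one, norm_iteratedFDeriv_eq_norm_iteratedDeriv, div_mul_eq_mul_div, le_div_iff₀ ha0,
    Real.norm_eq_abs]
  have hsum : ∀ i ≤ n, SchwartzMap.seminorm ℂ 0 i G + SchwartzMap.seminorm ℂ 1 i G ≤ B := by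
    intro i hi
    refine le_trans ?_ (le_add_of_nonneg_left (abs_nonneg _))
    exact Finset.single_le_sum
      (f := fun j => SchwartzMap.seminorm ℂ 0 j G + SchwartzMap.seminorm ℂ 1 j G)
      (fun j _ => add_nonneg (apply_nonneg _ _) (apply_nonneg _ _)) (Finset.mem_range.2 (by omega))
  cases j with
  | zero =>
    rw [iteratedDeriv_zero]
    refine (ha t).trans ?_
    gcongr
    exact (le_abs_self C).trans (le_add_of_nonneg_right
      (Finset.sum_nonneg fun j _ => add_nonneg (apply_nonneg _ _) (apply_nonneg _ _)))
  | succ j =>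
    have e3 : iteratedDeriv (j + 1) f t = iteratedDeriv j G (t + a) := by
      rw [hf, iteratedDeriv_fun_sub (g1.1.of_le (by exact_mod_cast le_top)).contDiffAt
        contDiffAt_const, iteratedDeriv_comp_add_const, iteratedDeriv_primitive hK]
      simp [iteratedDeriv_const]
    rw [e3]
    have h0 := SchwartzMap.le_seminorm' ℂ 0 j G (t + a)
    have h1 := SchwartzMap.le_seminorm' ℂ 1 j G (t + a)
    rw [pow_zero, one_mul] at h0
    rw [pow_one] at h1
    -- Peetre's inequality converts decay in t + a into decay in a.
    have h3 : 1 + |a| ≤ (1 + |t + a|) * (1 + |t|) := by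
      have := abs_sub (t + a) t
      rw [add_sub_cancel_left] at this
      nlinarith [abs_nonneg (t + a), abs_nonneg t]
    calc ‖iteratedDeriv j G (t + a)‖ * (1 + |a|)
        ≤ ‖iteratedDeriv j G (t + a)‖ * ((1 + |t + a|) * (1 + |t|)) := by gcongr
      _ = (‖iteratedDeriv j G (t + a)‖ + |t + a| * ‖iteratedDeriv j G (t + a)‖) * (1 + |t|) := by
        ring
      _ ≤ B * (1 + |t|) := by
        gcongr
        exact (add_le_add h0 h1).trans (hsum j (by omega))

end Translates

/-! ### Interchanging a tempered distribution with an integral over translations -/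

section Interchange

/-- Used on the two tails of ∫ G cut at t + a: there |a| ≤ |u| + |t|, so the first absolute moment
of `G` yields the rate 1/(1 + |a|) required by `tendsto_mulTranslate`. -/
theorem norm_setIntegral_mul_le (G : 𝓢(ℝ, ℂ)) {A : Set ℝ} (hA : MeasurableSet A) {a t : ℝ}
    (h : ∀ u ∈ A, 1 + |a| ≤ (1 + |u|) * (1 + |t|)) :
    ‖∫ u in A, G u‖ * (1 + |a|) ≤ (∫ u, (1 + |u|) * ‖G u‖) * (1 + |t|) := by
  have hi1 : Integrable (fun u => ‖G u‖) := G.integrable.norm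
  have hi2 : Integrable (fun u => (1 + |u|) * ‖G u‖) := by
    have := hi1.add (by simpa using G.integrable_pow_mul volume 1)
    refine this.congr (Filter.Eventually.of_forall fun u => ?_)
    simp [add_mul]
  calc ‖∫ u in A, G u‖ * (1 + |a|) ≤ (∫ u in A, ‖G u‖) * (1 + |a|) := by
        gcongr
        exact norm_integral_le_integral_norm _
    _ = ∫ u in A, ‖G u‖ * (1 + |a|) := (integral_mul_const _ _).symm
    _ ≤ ∫ u in A, (1 + |u|) * ‖G u‖ * (1 + |t|) := by
        refine setIntegral_mono_on (hi1.mul_const _).integrableOn (hi2.mul_const _).integrableOn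
          hA fun u hu => ?_
        calc ‖G u‖ * (1 + |a|) ≤ ‖G u‖ * ((1 + |u|) * (1 + |t|)) := by
              gcongr; exact h u hu
          _ = _ := by ring
    _ ≤ ∫ u, (1 + |u|) * ‖G u‖ * (1 + |t|) :=
        setIntegral_le_integral (hi2.mul_const _)
          (Filter.Eventually.of_forall fun u => by positivity)
    _ = _ := integral_mul_const _ _

theorem hasDerivAt_integral_Iic (G : 𝓢(ℝ, ℂ)) (t : ℝ) :
    HasDerivAt (fun t => ∫ u in Set.Iic t, G u) (G t) t := by
  have h1 : (fun t => ∫ u in Set.Iic t, G u)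
      = fun t => (∫ u in Set.Iic 0, G u) + ∫ u in (0 : ℝ)..t, G u := by
    funext t
    rw [← intervalIntegral.integral_Iic_sub_Iic G.integrable.integrableOn
      G.integrable.integrableOn]
    ring
  rw [h1]
  exact (G.continuous.integral_hasStrictDerivAt 0 t).hasDerivAt.const_add _

/-- Fubini's theorem for a tempered distribution and the translates of a Schwartz function. -/
theorem integral_mulTranslate (T : 𝓢(ℝ, ℂ) →L[ℂ] ℂ) (M G : 𝓢(ℝ, ℂ))
    (hJ : Integrable fun a => T (mulTranslate M G a)) :
    ∫ a, T (mulTranslate M G a) = (∫ t, G t) * T M := by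
  -- The interchange is the fundamental theorem of calculus in a: T(M(t) G(t + a)) is the derivative
  -- of T(M(t) K(t + a)), whose limits at -∞ and +∞ are 0 and (∫ G) T(M).
  set K : ℝ → ℂ := fun t => ∫ u in Set.Iic t, G u with hKdef
  have hK : ∀ t, HasDerivAt K (G t) t := hasDerivAt_integral_Iic G
  have hKt : K.HasTemperateGrowth := by
    refine primitive_hasTemperateGrowth hK (C := ∫ u, ‖G u‖) fun t => ?_
    refine (norm_integral_le_integral_norm _).trans ?_
    exact setIntegral_le_integral G.integrable.norm
      (Filter.Eventually.of_forall fun u => norm_nonneg _)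
  have hbot : Filter.Tendsto (fun a => T (mulTranslate M K a)) Filter.atBot (𝓝 (0 * T M)) := by
    refine tendsto_mulTranslate T M hK hKt Filter.tendsto_abs_atBot_atTop
      (C := ∫ u, (1 + |u|) * ‖G u‖) ?_
    filter_upwards [Filter.eventually_le_atBot 0] with a ha t
    rw [sub_zero]
    refine norm_setIntegral_mul_le G measurableSet_Iic fun u hu => ?_
    have hu' : u ≤ t + a := hu
    rw [abs_of_nonpos ha]
    nlinarith [le_abs_self t, neg_abs_le u, mul_nonneg (abs_nonneg u) (abs_nonneg t)]
  have htop : Filter.Tendsto (fun a => T (mulTranslate M K a)) Filter.atTop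
      (𝓝 ((∫ t, G t) * T M)) := by
    refine tendsto_mulTranslate T M hK hKt Filter.tendsto_abs_atTop_atTop
      (C := ∫ u, (1 + |u|) * ‖G u‖) ?_
    filter_upwards [Filter.eventually_ge_atTop 0] with a ha t
    have e : K (t + a) - ∫ t, G t = -∫ u in Set.Ioi (t + a), G u := by
      rw [← integral_add_compl (measurableSet_Iic (a := t + a)) G.integrable, Set.compl_Iic]
      ring
    rw [e, norm_neg]
    refine norm_setIntegral_mul_le G measurableSet_Ioi fun u hu => ?_
    have hu' : t + a < u := hu
    rw [abs_of_nonneg ha]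
    nlinarith [neg_abs_le t, le_abs_self u, mul_nonneg (abs_nonneg u) (abs_nonneg t)]
  rw [integral_of_hasDerivAt_of_tendsto (fun a => hasDerivAt_mulTranslate T M hK hKt a) hJ hbot
    htop]
  ring

end Interchange

/-! ### Slices of causal distributions and their exponential transform -/

section Slices

variable {w : 𝓢'(ℝ × ℝ, ℂ)} {φ : 𝓢(ℝ × ℝ, ℂ)} {F : 𝓢'(ℝ, ℂ)} {R : ℝ}

/-- The function vanishes for times `t > R`. -/
def RightBounded (R : ℝ) (φ : 𝓢(ℝ × ℝ, ℂ)) : Prop := ∀ p : ℝ × ℝ, R < p.2 → φ p = 0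

theorem slicePairing_timeShift (w : 𝓢'(ℝ × ℝ, ℂ)) (φ : 𝓢(ℝ × ℝ, ℂ)) (a τ : ℝ) :
    slicePairing w (timeShift a φ) τ = slicePairing w φ (τ + a) := by
  rw [slicePairing, slicePairing, ← timeShift_add, add_comm]

theorem timeShift_zero (φ : 𝓢(ℝ × ℝ, ℂ)) : timeShift 0 φ = φ := by
  ext p; simp [timeShift_apply]

theorem hasDerivAt_slicePairing (w : 𝓢'(ℝ × ℝ, ℂ)) (φ : 𝓢(ℝ × ℝ, ℂ)) (τ : ℝ) :
    HasDerivAt (slicePairing w φ) (slicePairing w (dt φ) τ) τ :=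
  hasDerivAt_timeShift (w.comp timeCutoff) φ τ

/-- If `W (timeShift a φ) = 0` for `a > 0`, then `W φ = 0`. -/
theorem apply_eq_zero_of_timeShift (W : 𝓢(ℝ × ℝ, ℂ) →L[ℂ] ℂ)
    (h : ∀ a > 0, W (timeShift a φ) = 0) : W φ = 0 := by
  have h1 : Filter.Tendsto (fun a => W (timeShift a φ)) (𝓝[>] 0) (𝓝 (W (timeShift 0 φ))) :=
    (hasDerivAt_timeShift W φ 0).continuousAt.tendsto.mono_left nhdsWithin_le_nhds
  rw [timeShift_zero] at h1
  refine tendsto_nhds_unique h1 (tendsto_const_nhds.congr' ?_)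
  filter_upwards [self_mem_nhdsWithin] with a ha using (h a ha).symm

/-- Causality only speaks of test functions whose closed support avoids t = 0. Shifting by a > 0
moves the support into t ≤ -a, and a → 0 gives the boundary case. -/
theorem IsCausal.apply_eq_zero (hw : IsCausal w) (h : ∀ p : ℝ × ℝ, 0 ≤ p.2 → φ p = 0) :
    w φ = 0 := by
  refine apply_eq_zero_of_timeShift w fun a ha => hw _ ?_
  have hcl : IsClosed {p : ℝ × ℝ | p.2 ≤ -a} := isClosed_le continuous_snd continuous_const
  refine (closure_minimal (fun p hp => ?_) hcl).trans fun p (hp : p.2 ≤ -a) => ?_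
  · by_contra hn
    have hn' : ¬ p.2 ≤ -a := hn
    exact hp (by rw [timeShift_apply]; exact h _ (by dsimp only; linarith))
  · show p.2 < 0
    linarith

theorem IsCausal.apply_congr (hw : IsCausal w) {φ ψ : 𝓢(ℝ × ℝ, ℂ)}
    (h : ∀ p : ℝ × ℝ, 0 ≤ p.2 → φ p = ψ p) : w φ = w ψ := by
  rw [← sub_eq_zero, ← map_sub]
  exact hw.apply_eq_zero fun p hp => by simp [h p hp]

theorem IsCausal.apply_timeCutoff (hw : IsCausal w) (φ : 𝓢(ℝ × ℝ, ℂ)) :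
    w (timeCutoff φ) = w φ :=
  hw.apply_congr fun p hp => by rw [timeCutoff_apply, cut_of_nonneg (by linarith), one_mul]

theorem IsCausal.slicePairing_zero (hw : IsCausal w) (φ : 𝓢(ℝ × ℝ, ℂ)) :
    slicePairing w φ 0 = w φ := by
  rw [slicePairing, timeShift_zero, hw.apply_timeCutoff]

/-- If φ vanishes for t ≥ 0, the slice of its shift by a > 0 vanishes for τ > -a, hence has closed
support in τ < 0, where `F` is zero. The limit a → 0 finishes. -/
theorem isCausal_timeConv (hF : Distribution.IsVanishingOn F (Set.Iio (0 : ℝ)))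
    (hw : IsCausal w) : IsCausal (timeConv F w) := by
  intro φ hφ
  have h0 : ∀ p : ℝ × ℝ, 0 ≤ p.2 → φ p = 0 := fun p hp => by
    by_contra hn
    exact absurd (hφ (subset_tsupport _ hn)) (not_lt.2 hp)
  refine apply_eq_zero_of_timeShift (timeConv F w) fun a ha => ?_
  change F (timePairing w (timeShift a φ)) = 0
  refine hF _ ?_
  refine (closure_minimal (fun τ hτ => ?_) (isClosed_Iic (a := -a))).trans
    fun τ (hτ : τ ≤ -a) => show τ < 0 by linarith
  by_contra hn
  have hn' : -a < τ := not_le.1 hn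
  apply hτ
  rw [timePairing_apply, hw.apply_timeCutoff, hw.apply_eq_zero, mul_zero]
  intro p hp
  rw [timeShift_apply, timeShift_apply]
  exact h0 _ (by dsimp only; linarith)

theorem RightBounded.dt (h : RightBounded R φ) : RightBounded R (dt φ) := by
  intro p hp
  have h1 : (φ : ℝ × ℝ → ℂ) =ᶠ[𝓝 p] fun _ => 0 := by
    filter_upwards [(isOpen_lt continuous_const continuous_snd).mem_nhds hp] with q hq
      using h q hq
  rw [SchwartzMap.lineDerivOp_apply_eq_fderiv, h1.fderiv_eq]
  simp

/-- The 1 in `R + 1` is the width of the time cutoff: where `cut` is nonzero, t > -1, so t + τ > R.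
-/
theorem RightBounded.slicePairing_eq_zero (h : RightBounded R φ) {τ : ℝ} (hτ : R + 1 ≤ τ) :
    slicePairing w φ τ = 0 := by
  have : timeCutoff (timeShift τ φ) = 0 := by
    ext p
    rw [timeCutoff_apply, timeShift_apply]
    rcases le_or_gt p.2 (-1) with hp | hp
    · simp [cut_of_le hp]
    · rw [h _ (by dsimp only; linarith)]
      simp
  rw [slicePairing, this, map_zero]

theorem seminorm_timeShift_le (k n : ℕ) (φ : 𝓢(ℝ × ℝ, ℂ)) :
    ∃ C : ℝ, 0 ≤ C ∧ ∀ τ : ℝ, SchwartzMap.seminorm ℂ k n (timeShift τ φ) ≤ C * (1 + |τ|) ^ k := by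
  refine ⟨2 ^ k * (Finset.Iic (k, n)).sup (fun m => SchwartzMap.seminorm ℂ m.1 m.2) φ,
    by positivity, fun τ => ?_⟩
  refine SchwartzMap.seminorm_le_bound ℂ k n _ (by positivity) fun p => ?_
  set q := p + ((0 : ℝ), τ) with hq
  have h1 : ‖p‖ ≤ (1 + ‖q‖) * (1 + |τ|) := by
    have h2 : ‖p‖ ≤ ‖q‖ + ‖((0 : ℝ), τ)‖ := by
      have := norm_sub_le q ((0 : ℝ), τ)
      rwa [hq, add_sub_cancel_right] at this
    have h3 : ‖((0 : ℝ), τ)‖ = |τ| := by simp [Prod.norm_def]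
    nlinarith [norm_nonneg q, abs_nonneg τ]
  have h4 := SchwartzMap.one_add_le_sup_seminorm_apply (𝕜 := ℂ) (m := (k, n)) le_rfl le_rfl φ q
  rw [iteratedFDeriv_timeShift]
  calc ‖p‖ ^ k * ‖iteratedFDeriv ℝ n φ q‖
      ≤ ((1 + ‖q‖) * (1 + |τ|)) ^ k * ‖iteratedFDeriv ℝ n φ q‖ := by gcongr
    _ = ((1 + ‖q‖) ^ k * ‖iteratedFDeriv ℝ n φ q‖) * (1 + |τ|) ^ k := by rw [mul_pow]; ring
    _ ≤ _ := by gcongr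

theorem norm_slicePairing_le (w : 𝓢'(ℝ × ℝ, ℂ)) (φ : 𝓢(ℝ × ℝ, ℂ)) :
    ∃ (N : ℕ) (C : ℝ), 0 ≤ C ∧ ∀ τ : ℝ, ‖slicePairing w φ τ‖ ≤ C * (1 + |τ|) ^ N := by
  obtain ⟨n, C, hC0, hC⟩ := exists_norm_le_sum_seminorm (w.comp timeCutoff)
  choose D hD0 hD using fun i : ℕ × ℕ => seminorm_timeShift_le i.1 i.2 φ
  refine ⟨n, C * ∑ i ∈ Finset.Iic (n, n), D i,
    mul_nonneg hC0 (Finset.sum_nonneg fun i _ => hD0 i), fun τ => ?_⟩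
  refine (hC (timeShift τ φ)).trans ?_
  rw [mul_assoc, Finset.sum_mul]
  refine mul_le_mul_of_nonneg_left (Finset.sum_le_sum fun i hi => (hD i τ).trans ?_) hC0
  refine mul_le_mul_of_nonneg_left ?_ (hD0 i)
  exact pow_le_pow_right₀ (by linarith [abs_nonneg τ]) (Finset.mem_Iic.1 hi).1

/-- Conjugation by e^{sτ} turns d/dτ into s + d/dτ, and d/dτ falls on the test function. Derivatives
of e^{sτ}·slice are thus again of this form, so for `expSlice` to be Schwartz it suffices to bound
the functions themselves. -/
theorem iteratedDeriv_exp_mul_slicePairing (w : 𝓢'(ℝ × ℝ, ℂ)) (s : ℂ) (n : ℕ)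
    (φ : 𝓢(ℝ × ℝ, ℂ)) :
    iteratedDeriv n (fun τ : ℝ => Complex.exp (s * τ) * slicePairing w φ τ)
      = fun τ : ℝ => Complex.exp (s * τ) * slicePairing w ((fun ψ => s • ψ + dt ψ)^[n] φ) τ := by
  induction n generalizing φ with
  | zero => simp
  | succ n ih =>
    rw [iteratedDeriv_succ', Function.iterate_succ_apply, ← ih]
    congr 1
    funext τ
    have h1 : HasDerivAt (fun τ : ℝ => s * (τ : ℂ)) (s * 1) τ :=
      (Complex.ofRealCLM.hasDerivAt (x := τ)).const_mul s
    rw [(h1.cexp.fun_mul (hasDerivAt_slicePairing w φ τ)).deriv]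
    simp only [slicePairing, map_add, map_smul, smul_eq_mul]
    ring

/-- The slice grows at most polynomially and vanishes for τ ≥ R + 1. For smaller τ the factor e^{sτ}
decays exponentially as τ → -∞. -/
theorem exp_mul_slicePairing_decay (w : 𝓢'(ℝ × ℝ, ℂ)) (h : RightBounded R φ) {s : ℂ}
    (hs : 0 < s.re) (k : ℕ) :
    ∃ C : ℝ, ∀ τ : ℝ, ‖τ‖ ^ k * ‖Complex.exp (s * τ) * slicePairing w φ τ‖ ≤ C := by
  obtain ⟨N, C, hC0, hC⟩ := norm_slicePairing_le w φ
  obtain ⟨A, hA0, hA⟩ := bddAbove_pow_mul_exp (k + N) hs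
  refine ⟨C * (1 + |R|) ^ (k + N) * Real.exp (s.re * R) * A, fun τ => ?_⟩
  rcases le_or_gt (R + 1) τ with hτ | hτ
  · rw [h.slicePairing_eq_zero hτ, mul_zero, norm_zero, mul_zero]
    positivity
  · have h1 : 1 + |τ| ≤ (1 + |R|) * (1 + |R - τ|) := by
      have := abs_sub R (R - τ)
      rw [sub_sub_cancel] at this
      nlinarith [abs_nonneg R, abs_nonneg (R - τ)]
    -- In the variable R - τ > -1 this is the exponential treated in `bddAbove_pow_mul_exp`.
    have h2 : ‖Complex.exp (s * τ)‖ = Real.exp (s.re * R) * Real.exp (-s.re * (R - τ)) := by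
      rw [Complex.norm_exp, ← Real.exp_add]
      congr 1
      simp
      ring
    rw [norm_mul, h2, Real.norm_eq_abs]
    calc |τ| ^ k * (Real.exp (s.re * R) * Real.exp (-s.re * (R - τ)) * ‖slicePairing w φ τ‖)
        ≤ (1 + |τ|) ^ k * (Real.exp (s.re * R) * Real.exp (-s.re * (R - τ)) *
            (C * (1 + |τ|) ^ N)) := by
          gcongr
          · linarith
          · exact hC τ
      _ = C * Real.exp (s.re * R) * ((1 + |τ|) ^ (k + N) * Real.exp (-s.re * (R - τ))) := by
          ring
      _ ≤ C * Real.exp (s.re * R) *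
            (((1 + |R|) * (1 + |R - τ|)) ^ (k + N) * Real.exp (-s.re * (R - τ))) := by gcongr
      _ = C * (1 + |R|) ^ (k + N) * Real.exp (s.re * R) *
            ((1 + |R - τ|) ^ (k + N) * Real.exp (-s.re * (R - τ))) := by rw [mul_pow]; ring
      _ ≤ _ := by
          gcongr
          exact hA _ (by linarith)

/-- The Schwartz function `τ ↦ e^{sτ} ⟨w(x,t), φ(x,t+τ)⟩`. -/
def expSlice (w : 𝓢'(ℝ × ℝ, ℂ)) (h : RightBounded R φ) {s : ℂ} (hs : 0 < s.re) : 𝓢(ℝ, ℂ) where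
  toFun τ := Complex.exp (s * τ) * slicePairing w φ τ
  smooth' := by
    have : ContDiff ℝ ∞ (fun t : ℝ => (t : ℂ)) := Complex.ofRealCLM.contDiff
    exact (contDiff_const.mul this).cexp.mul (slicePairing_contDiff w φ)
  decay' k n := by
    have h' : RightBounded R ((fun ψ => s • ψ + FracWave.dt ψ)^[n] φ) := by
      induction n with
      | zero => exact h
      | succ n ih =>
        rw [Function.iterate_succ_apply']
        intro p hp
        simp [ih p hp, ih.dt p hp]
    obtain ⟨C, hC⟩ := exp_mul_slicePairing_decay w h' hs k
    refine ⟨C, fun τ => ?_⟩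
    rw [norm_iteratedFDeriv_eq_norm_iteratedDeriv, iteratedDeriv_exp_mul_slicePairing]
    exact hC τ

theorem expSlice_apply (w : 𝓢'(ℝ × ℝ, ℂ)) (h : RightBounded R φ) {s : ℂ} (hs : 0 < s.re)
    (τ : ℝ) : expSlice w h hs τ = Complex.exp (s * τ) * slicePairing w φ τ := rfl

/-- The two-sided transform `∫ e^{sτ} ⟨w(x,t), φ(x,t+τ)⟩ dτ`. -/
def sliceTransform (w : 𝓢'(ℝ × ℝ, ℂ)) (φ : 𝓢(ℝ × ℝ, ℂ)) (s : ℂ) : ℂ :=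
  ∫ τ : ℝ, Complex.exp (s * τ) * slicePairing w φ τ

/-- The transform turns convolution in time into multiplication by the Laplace transform. -/
theorem sliceTransform_timeConv (hF : Distribution.IsVanishingOn F (Set.Iio (0 : ℝ)))
    (hw : IsCausal w) (h : RightBounded R φ) {s : ℂ} (hs : 0 < s.re) :
    sliceTransform (timeConv F w) φ s = laplace F s hs * sliceTransform w φ s := by
  -- The factor e^{-sτ} of `expTest` cancels part of e^{s(τ + a)} and leaves e^{sa}, so the slice of
  -- the convolution becomes `F` applied to a Schwartz function times a translate.
  have key : ∀ a, expSlice (timeConv F w) h hs a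
      = (F : 𝓢(ℝ, ℂ) →L[ℂ] ℂ) (mulTranslate (expTest s hs) (expSlice w h hs) a) := by
    intro a
    rw [expSlice_apply, slicePairing, (isCausal_timeConv hF hw).apply_timeCutoff, timeConv_apply,
      ← smul_eq_mul, ← map_smul]
    congr 1
    ext τ
    rw [smul_apply, timePairing_apply, mulTranslate, SchwartzMap.smulLeftCLM_apply_apply
      (hasTemperateGrowth_add_const (expSlice w h hs).hasTemperateGrowth a)]
    have e1 : w (timeCutoff (timeShift τ (timeShift a φ))) = slicePairing w φ (τ + a) :=
      slicePairing_timeShift w φ a τ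
    have e2 : expTest s hs τ = cut τ * Complex.exp (-s * τ) := rfl
    have e3 : Complex.exp (s * ((τ + a : ℝ) : ℂ)) * Complex.exp (-s * τ) = Complex.exp (s * a) := by
      rw [← Complex.exp_add]
      congr 1
      push_cast
      ring
    rw [e1, e2, expSlice_apply, smul_eq_mul, smul_eq_mul, ← e3]
    ring
  -- The integrability required here is free: by `key` the integrand is the Schwartz function
  -- `expSlice` of the convolution.
  have h1 := integral_mulTranslate (F : 𝓢(ℝ, ℂ) →L[ℂ] ℂ) (expTest s hs) (expSlice w h hs)
    ((expSlice (timeConv F w) h hs).integrable.congr (Filter.Eventually.of_forall key))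
  rw [mul_comm]
  refine Eq.trans ?_ h1
  exact integral_congr_ae (Filter.Eventually.of_forall key)

theorem sliceTransform_sub (v w : 𝓢'(ℝ × ℝ, ℂ)) (h : RightBounded R φ) {s : ℂ} (hs : 0 < s.re) :
    sliceTransform (v - w) φ s = sliceTransform v φ s - sliceTransform w φ s := by
  refine Eq.trans ?_
    (integral_sub (expSlice v h hs).integrable (expSlice w h hs).integrable)
  refine integral_congr_ae (Filter.Eventually.of_forall fun τ => ?_)
  simp only [← mul_sub]
  rfl

end Slices

/-! ### Holomorphy and injectivity of the transform -/

section Uniqueness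

variable {w : 𝓢'(ℝ × ℝ, ℂ)} {φ : 𝓢(ℝ × ℝ, ℂ)} {F : 𝓢'(ℝ, ℂ)} {R : ℝ}

theorem differentiableAt_sliceTransform (w : 𝓢'(ℝ × ℝ, ℂ)) (h : RightBounded R φ) {s : ℂ}
    (hs : 0 < s.re) : DifferentiableAt ℂ (sliceTransform w φ) s := by
  -- On the disc of radius c about s one has c < Re z < 3c, so |e^{zτ}| is at most the sum of the
  -- two exponentials at the ends, whatever the sign of τ.
  set c := s.re / 2 with hc
  have hc0 : 0 < c := by positivity
  have h1 : 0 < ((c : ℝ) : ℂ).re := by simpa using hc0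
  have h2 : 0 < ((3 * c : ℝ) : ℂ).re := by simpa using hc0
  have hi : ∀ {z : ℂ} (hz : 0 < z.re),
      Integrable fun τ : ℝ => |τ| * ‖Complex.exp (z * τ) * slicePairing w φ τ‖ := fun hz => by
    have := (expSlice w h hz).integrable_pow_mul volume 1
    simp only [pow_one, expSlice_apply, Real.norm_eq_abs] at this
    exact this
  refine (hasDerivAt_integral_of_dominated_loc_of_deriv_le
    (F := fun (z : ℂ) (τ : ℝ) => Complex.exp (z * τ) * slicePairing w φ τ)
    (F' := fun (z : ℂ) (τ : ℝ) => Complex.exp (z * τ) * τ * slicePairing w φ τ)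
    (bound := fun τ : ℝ => |τ| * ‖Complex.exp ((c : ℝ) * τ) * slicePairing w φ τ‖ +
      |τ| * ‖Complex.exp ((3 * c : ℝ) * τ) * slicePairing w φ τ‖)
    (Metric.ball_mem_nhds s hc0) ?_ ?_ ?_ ?_ ?_ ?_).2.differentiableAt
  · filter_upwards [(isOpen_lt continuous_const Complex.continuous_re).mem_nhds hs] with z hz
    exact (expSlice w h hz).integrable.aestronglyMeasurable
  · exact (expSlice w h hs).integrable
  · have hcont : Continuous (slicePairing w φ) := (slicePairing_contDiff w φ).continuous
    exact Continuous.aestronglyMeasurable (by fun_prop)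
  · refine Filter.Eventually.of_forall fun τ z hz => ?_
    have hz' : |z.re - s.re| < c := by
      have := (Complex.abs_re_le_norm (z - s)).trans_lt (by simpa [dist_eq_norm] using hz)
      simpa using this
    have hzr := abs_lt.1 hz'
    have key : ‖Complex.exp (z * τ)‖ ≤
        ‖Complex.exp ((c : ℝ) * τ)‖ + ‖Complex.exp ((3 * c : ℝ) * τ)‖ := by
      simp only [Complex.norm_exp, Complex.re_mul_ofReal, Complex.ofReal_re]
      rcases le_total 0 τ with ht | ht
      · refine le_add_of_nonneg_of_le (Real.exp_pos _).le (Real.exp_le_exp.2 ?_)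
        exact mul_le_mul_of_nonneg_right (by linarith) ht
      · refine le_add_of_le_of_nonneg (Real.exp_le_exp.2 ?_) (Real.exp_pos _).le
        exact mul_le_mul_of_nonpos_right (by linarith) ht
    simp only [norm_mul, Complex.norm_real, Real.norm_eq_abs]
    calc ‖Complex.exp (z * τ)‖ * |τ| * ‖slicePairing w φ τ‖
        ≤ (‖Complex.exp ((c : ℝ) * τ)‖ + ‖Complex.exp ((3 * c : ℝ) * τ)‖) * |τ| *
            ‖slicePairing w φ τ‖ := by gcongr
      _ = _ := by ring
  · exact (hi h1).add (hi h2)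
  · refine Filter.Eventually.of_forall fun τ z _ => ?_
    have h3 : HasDerivAt (fun z : ℂ => z * τ) τ z := by
      simpa using (hasDerivAt_id z).mul_const (τ : ℂ)
    exact h3.cexp.mul_const _

theorem sliceTransform_eq_zero (h : RightBounded R φ) {s₀ : ℂ} (hs₀ : 0 < s₀.re)
    (h0 : ∀ᶠ s in 𝓝 s₀, sliceTransform w φ s = 0) {s : ℂ} (hs : 0 < s.re) :
    sliceTransform w φ s = 0 := by
  have hU : IsOpen {z : ℂ | 0 < z.re} := isOpen_lt continuous_const Complex.continuous_re
  have ha : AnalyticOnNhd ℂ (sliceTransform w φ) {z : ℂ | 0 < z.re} :=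
    DifferentiableOn.analyticOnNhd
      (fun z hz => (differentiableAt_sliceTransform w h hz).differentiableWithinAt) hU
  exact ha.eqOn_zero_of_preconnected_of_eventuallyEq_zero
    (convex_halfSpace_re_gt 0).isPreconnected hs₀ h0 hs

/-- By the identity theorem the transform vanishes on the whole half-plane, in particular on Re s =
1, where it is the Fourier transform of `expSlice` at s = 1 - 2πiy. Fourier inversion kills the
slice, whose value at τ = 0 is w φ. -/
theorem apply_eq_zero_of_sliceTransform (hw : IsCausal w) (h : RightBounded R φ) {s₀ : ℂ}
    (hs₀ : 0 < s₀.re) (h0 : ∀ᶠ s in 𝓝 s₀, sliceTransform w φ s = 0) : w φ = 0 := by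
  have h1 : 0 < (1 : ℂ).re := by simp
  have hF : FourierTransform.fourier (expSlice w h h1) = 0 := by
    ext y
    rw [SchwartzMap.fourier_coe, Real.fourier_eq']
    have hs : 0 < (1 - 2 * Real.pi * y * Complex.I).re := by simp
    rw [zero_apply, ← sliceTransform_eq_zero h hs₀ h0 hs, sliceTransform]
    congr 1
    funext τ
    rw [expSlice_apply, smul_eq_mul, ← mul_assoc, ← Complex.exp_add]
    congr 2
    simp
    ring
  have hG : expSlice w h h1 = 0 := by
    refine (FourierTransform.fourierCLE ℂ 𝓢(ℝ, ℂ)).injective ?_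
    rw [map_zero, FourierTransform.fourierCLE_apply, hF]
  have h2 := DFunLike.congr_fun hG 0
  rw [expSlice_apply, hw.slicePairing_zero] at h2
  simpa using h2

/-- The cutoff `cut (t - R)` in time, which vanishes for `t ≤ R - 1`. -/
def lateCut (R : ℝ) (p : ℝ × ℝ) : ℂ := cut (p.2 - R)

theorem lateCut_eq (R : ℝ) : lateCut R = fun p => (fun q : ℝ × ℝ => cut q.2) (p + (0, -R)) := by
  funext p
  simp [lateCut, sub_eq_add_neg]

theorem lateCut_hasTemperateGrowth (R : ℝ) : (lateCut R).HasTemperateGrowth := by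
  rw [lateCut_eq]
  exact cut_snd_hasTemperateGrowth.comp (by fun_prop)

/-- Test functions vanishing for large times are dense. -/
theorem eq_zero_of_rightBounded (W : 𝓢(ℝ × ℝ, ℂ) →L[ℂ] ℂ)
    (h : ∀ (R : ℝ) (φ : 𝓢(ℝ × ℝ, ℂ)), RightBounded R φ → W φ = 0) : W = 0 := by
  ext φ
  obtain ⟨n, hn⟩ := norm_apply_smulLeft_le W
  obtain ⟨k, C, hC0, hcut⟩ := cut_snd_hasTemperateGrowth.norm_iteratedFDeriv_le_uniform n
  obtain ⟨D, hD0, hD⟩ := hn φ (k + 1)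
  -- The difference between φ and its late part vanishes for t > R, so `W` sees only the late part,
  -- for every R.
  have hW : ∀ R : ℝ, W φ = W (SchwartzMap.smulLeftCLM ℂ (lateCut R) φ) := by
    intro R
    rw [← sub_eq_zero, ← map_sub]
    refine h R _ fun p hp => ?_
    rw [sub_apply, SchwartzMap.smulLeftCLM_apply_apply (lateCut_hasTemperateGrowth R),
      lateCut, cut_of_nonneg (by linarith), one_smul, sub_self]
  -- On the support of the late cutoff R ≤ 1 + ‖p‖, so one extra weight 1 + ‖p‖ buys a factor 1/R.
  have hb : ∀ R : ℝ, 0 < R → ‖W φ‖ ≤ D * (C * 2 ^ k / R) := by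
    intro R hR
    rw [hW R]
    refine hD _ (lateCut_hasTemperateGrowth R) _ (by positivity) fun j hj p => ?_
    rcases lt_or_ge p.2 (R - 1) with hp | hp
    · have h0 : lateCut R =ᶠ[𝓝 p] fun _ => (0 : ℂ) := by
        filter_upwards [(isOpen_lt continuous_snd continuous_const).mem_nhds hp] with q hq
        have hq' : q.2 < R - 1 := hq
        exact cut_of_le (by linarith)
      rw [h0.iteratedFDeriv ℝ j |>.eq_of_nhds]
      simp
      positivity
    · have hp2 : R ≤ 1 + ‖p‖ := by
        have : p.2 ≤ ‖p‖ := (le_abs_self _).trans (norm_snd_le p)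
        linarith
      rw [lateCut_eq, iteratedFDeriv_comp_add_right (f := fun q : ℝ × ℝ => cut q.2)]
      refine (hcut j hj _).trans ?_
      have hq : 1 + ‖p + ((0 : ℝ), -R)‖ ≤ 2 * (1 + ‖p‖) := by
        have h1 := norm_add_le p ((0 : ℝ), -R)
        have h2 : ‖((0 : ℝ), -R)‖ = R := by simp [Prod.norm_def, abs_of_pos hR, hR.le]
        linarith
      calc C * (1 + ‖p + ((0 : ℝ), -R)‖) ^ k ≤ C * (2 * (1 + ‖p‖)) ^ k := by gcongr
        _ = C * 2 ^ k / R * ((1 + ‖p‖) ^ k * R) := by rw [mul_pow]; field_simp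
        _ ≤ C * 2 ^ k / R * ((1 + ‖p‖) ^ k * (1 + ‖p‖)) := by gcongr
        _ = _ := by rw [pow_succ]
  have hlim : Filter.Tendsto (fun R : ℝ => D * (C * 2 ^ k / R)) Filter.atTop (𝓝 0) := by
    simpa using (tendsto_const_nhds.div_atTop Filter.tendsto_id).const_mul D
  have h0 : ‖W φ‖ ≤ 0 := ge_of_tendsto hlim
    ((Filter.eventually_gt_atTop 0).mono fun R hR => hb R hR)
  simpa using h0

/-- A causal distribution is determined by its transforms near one point. -/
theorem eq_of_sliceTransform {v w : 𝓢'(ℝ × ℝ, ℂ)} (hv : IsCausal v) (hw : IsCausal w) {s₀ : ℂ}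
    (hs₀ : 0 < s₀.re)
    (h0 : ∀ (R : ℝ) (φ : 𝓢(ℝ × ℝ, ℂ)), RightBounded R φ →
      ∀ᶠ s in 𝓝 s₀, sliceTransform v φ s = sliceTransform w φ s) : v = w := by
  have hvw : IsCausal (v - w) := fun φ hφ => by
    change v φ - w φ = 0
    rw [hv φ hφ, hw φ hφ, sub_zero]
  have h1 := eq_zero_of_rightBounded (v - w) fun R φ hφ => by
    refine apply_eq_zero_of_sliceTransform hvw hφ hs₀ ?_
    filter_upwards [h0 R φ hφ, (isOpen_lt continuous_const Complex.continuous_re).mem_nhds hs₀]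
      with s hs hs'
    rw [sliceTransform_sub v w hφ hs', hs, sub_self]
  exact sub_eq_zero.1 h1

/-- The Laplace transform of a causal distribution does not vanish near a point where it is
nonzero. -/
theorem eventually_laplace_ne_zero (hF : Distribution.IsVanishingOn F (Set.Iio (0 : ℝ))) {s₀ : ℂ}
    (hs₀ : 0 < s₀.re) (h0 : laplace F s₀ hs₀ ≠ 0) :
    ∀ᶠ s in 𝓝 s₀, ∀ hs : 0 < s.re, laplace F s hs ≠ 0 := by
  -- Continuity of the Laplace transform is read off from `sliceTransform` with w = δ. The test
  -- function is a bump times e^{-i t Im s₀}: the phase cancels that of e^{s₀τ}, which leaves the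
  -- integral of a nonnegative function that is positive at 0.
  obtain ⟨b, hb⟩ : ∃ b : ContDiffBump (0 : ℝ × ℝ), b.rOut = 2 :=
    ⟨⟨1, 2, one_pos, one_lt_two⟩, rfl⟩
  have hsm : ContDiff ℝ ∞ fun p : ℝ × ℝ => (b p : ℂ) * Complex.exp (-(s₀.im * p.2) * Complex.I) := by
    refine (Complex.ofRealCLM.contDiff.comp b.contDiff).mul ?_
    have : ContDiff ℝ ∞ (fun p : ℝ × ℝ => (p.2 : ℂ)) := Complex.ofRealCLM.contDiff.comp contDiff_snd
    exact (((contDiff_const.mul this).neg).mul contDiff_const).cexp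
  have hcs : HasCompactSupport fun p : ℝ × ℝ =>
      (b p : ℂ) * Complex.exp (-(s₀.im * p.2) * Complex.I) := by
    refine HasCompactSupport.mul_right ?_
    exact b.hasCompactSupport.comp_left (g := fun x : ℝ => (x : ℂ)) (by simp)
  set φ : 𝓢(ℝ × ℝ, ℂ) := hcs.toSchwartzMap hsm with hφ
  have hφa : ∀ p, φ p = (b p : ℂ) * Complex.exp (-(s₀.im * p.2) * Complex.I) := fun p => rfl
  have hR : RightBounded 2 φ := by
    intro p hp
    rw [hφa, b.zero_of_le_dist, Complex.ofReal_zero, zero_mul]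
    rw [dist_zero_right, hb]
    exact hp.le.trans ((le_abs_self _).trans (norm_snd_le p))
  set δ : 𝓢'(ℝ × ℝ, ℂ) := TemperedDistribution.delta (0 : ℝ × ℝ)
  have hδ : IsCausal δ := by
    intro u hu
    by_contra hn
    have : (0 : ℝ × ℝ) ∈ tsupport u := subset_tsupport _ hn
    simpa using hu this
  have hsl : ∀ τ, slicePairing δ φ τ = φ (0, τ) := by
    intro τ
    change timeCutoff (timeShift τ φ) 0 = _
    rw [timeCutoff_apply, timeShift_apply, Prod.snd_zero, cut_of_nonneg (by norm_num)]
    simp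
  have hne : sliceTransform δ φ s₀ ≠ 0 := by
    have e : ∀ τ : ℝ, Complex.exp (s₀ * τ) * slicePairing δ φ τ
        = ((Real.exp (s₀.re * τ) * b (0, τ) : ℝ) : ℂ) := by
      intro τ
      rw [hsl, hφa, mul_left_comm, ← Complex.exp_add]
      push_cast
      rw [mul_comm]
      congr 2
      nth_rewrite 1 [← Complex.re_add_im s₀]
      ring
    have hcb : Continuous fun τ : ℝ => b ((0 : ℝ), τ) := b.continuous.comp (by fun_prop)
    have hpos : 0 < ∫ τ : ℝ, Real.exp (s₀.re * τ) * b (0, τ) := by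
      refine Continuous.integral_pos_of_hasCompactSupport_nonneg_nonzero (x := 0)
        ((by fun_prop : Continuous fun τ : ℝ => Real.exp (s₀.re * τ)).mul hcb) ?_
        (fun τ => mul_nonneg (Real.exp_pos _).le b.nonneg) ?_
      · refine HasCompactSupport.mul_left ?_
        refine HasCompactSupport.of_support_subset_isCompact (isCompact_Icc (a := (-2 : ℝ)) (b := 2))
          fun τ hτ => ?_
        by_contra hn
        refine hτ (b.zero_of_le_dist ?_)
        rw [Set.mem_Icc, ← abs_le, not_le] at hn
        rw [dist_zero_right, hb]
        exact hn.le.trans (norm_snd_le ((0 : ℝ), τ))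
      · rw [b.one_of_mem_closedBall (by simpa [Prod.mk_zero_zero] using b.rIn_pos.le)]
        simp
    rw [sliceTransform, integral_congr_ae (Filter.Eventually.of_forall e), integral_complex_ofReal]
    exact_mod_cast hpos.ne'
  have hne' : sliceTransform (timeConv F δ) φ s₀ ≠ 0 := by
    rw [sliceTransform_timeConv hF hδ hR hs₀]
    exact mul_ne_zero h0 hne
  filter_upwards [(differentiableAt_sliceTransform (timeConv F δ) hR hs₀).continuousAt.eventually_ne
    hne'] with s h1 hs h2
  rw [sliceTransform_timeConv hF hδ hR hs, h2, zero_mul] at h1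
  exact h1 rfl

end Uniqueness

/-! ### Analytic continuation of the kernels f_β and their Laplace transforms -/

section Kernel

theorem schwartz_isBigO_atTop (ψ : 𝓢(ℝ, ℂ)) (a : ℝ) :
    (ψ : ℝ → ℂ) =O[Filter.atTop] (fun t : ℝ => t ^ (-a)) := by
  refine ((ψ.isBigO_cocompact_rpow (-a)).mono atTop_le_cocompact).congr' .rfl ?_
  filter_upwards [Filter.eventually_ge_atTop 0] with t ht
  rw [Real.norm_of_nonneg ht]

theorem schwartz_isBigO_zero (ψ : 𝓢(ℝ, ℂ)) :
    (ψ : ℝ → ℂ) =O[𝓝[>] 0] (fun t : ℝ => t ^ (-(0 : ℝ))) := by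
  simp only [neg_zero, Real.rpow_zero]
  exact ((ψ.continuous.tendsto 0).mono_left nhdsWithin_le_nhds).isBigO_one ℝ

theorem schwartz_mellinConvergent (ψ : 𝓢(ℝ, ℂ)) {u : ℂ} (hu : 0 < u.re) :
    MellinConvergent ψ u :=
  mellinConvergent_of_isBigO_rpow (ψ.continuous.locallyIntegrable.locallyIntegrableOn _)
    (schwartz_isBigO_atTop ψ (u.re + 1)) (lt_add_one _) (schwartz_isBigO_zero ψ) hu

theorem schwartz_mellin_differentiableAt (ψ : 𝓢(ℝ, ℂ)) {u : ℂ} (hu : 0 < u.re) :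
    DifferentiableAt ℂ (mellin ψ) u :=
  mellin_differentiableAt_of_isBigO_rpow (ψ.continuous.locallyIntegrable.locallyIntegrableOn _)
    (schwartz_isBigO_atTop ψ (u.re + 1)) (lt_add_one _) (schwartz_isBigO_zero ψ) hu

/-- Integration by parts; Re u > 0 removes the boundary term at 0 and Schwartz decay the one at
infinity. -/
theorem mellin_derivCLM (ψ : 𝓢(ℝ, ℂ)) {u : ℂ} (hu : 0 < u.re) :
    mellin (SchwartzMap.derivCLM ℂ ℂ ψ) (u + 1) = -u * mellin ψ u := by
  have hne : u ≠ 0 := fun h => by simp [h] at hu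
  have hu1 : 0 < (u + 1).re := by simp; linarith
  have c1 := schwartz_mellinConvergent (SchwartzMap.derivCLM ℂ ℂ ψ) hu1
  have c2 := schwartz_mellinConvergent ψ hu
  rw [MellinConvergent, add_sub_cancel_right] at c1
  rw [MellinConvergent] at c2
  simp only [smul_eq_mul] at c1 c2
  have h1 : ∀ t ∈ Set.Ioi (0 : ℝ), HasDerivAt (fun t : ℝ => (t : ℂ) ^ u)
      (u * (t : ℂ) ^ (u - 1)) t := by
    intro t ht
    have h := ((hasDerivAt_id (t : ℂ)).cpow_const (c := u)
      (Or.inl (by simpa using ht))).comp_ofReal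
    simpa using h
  have h2 : ∀ t ∈ Set.Ioi (0 : ℝ), HasDerivAt ψ (SchwartzMap.derivCLM ℂ ℂ ψ t) t := by
    intro t _
    rw [SchwartzMap.derivCLM_apply]
    exact ψ.differentiableAt.hasDerivAt
  have h0 : Filter.Tendsto ((fun t : ℝ => (t : ℂ) ^ u) * ⇑ψ) (𝓝[>] 0) (𝓝 0) := by
    have h3 : Filter.Tendsto (fun t : ℝ => (t : ℂ) ^ u) (𝓝 0) (𝓝 0) := by
      have := (Complex.continuousAt_ofReal_cpow_const 0 u (Or.inl hu)).tendsto
      rwa [Complex.ofReal_zero, Complex.zero_cpow hne] at this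
    have := h3.mul (ψ.continuous.tendsto 0)
    rw [zero_mul] at this
    exact this.mono_left nhdsWithin_le_nhds
  have hinf : Filter.Tendsto ((fun t : ℝ => (t : ℂ) ^ u) * ⇑ψ) Filter.atTop (𝓝 0) := by
    have h3 : (fun t : ℝ => (t : ℂ) ^ u) =O[Filter.atTop] fun t : ℝ => t ^ u.re := by
      refine Asymptotics.IsBigO.of_bound 1 ?_
      filter_upwards [Filter.eventually_gt_atTop 0] with t ht
      rw [Complex.norm_cpow_eq_rpow_re_of_pos ht, one_mul,
        Real.norm_of_nonneg (Real.rpow_nonneg ht.le _)]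
    have h4 := h3.mul (schwartz_isBigO_atTop ψ (u.re + 1))
    refine h4.trans_tendsto ?_
    refine (tendsto_rpow_neg_atTop one_pos).congr' ?_
    filter_upwards [Filter.eventually_gt_atTop 0] with t ht
    rw [← Real.rpow_add ht]
    congr 1
    ring
  have key := integral_Ioi_mul_deriv_eq_deriv_mul h1 h2 c1 (by
    refine (c2.const_mul u).congr (Filter.Eventually.of_forall fun t => ?_)
    simp [mul_assoc]) h0 hinf
  rw [sub_zero, zero_sub] at key
  rw [mellin, mellin, add_sub_cancel_right]
  simp only [smul_eq_mul]
  rw [key, ← integral_const_mul, ← integral_neg]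
  congr 1
  funext t
  ring

/-- The analytic continuation `⟨f_z, ψ⟩`, valid for `Re z + N > 0`, of the pairing with
`t^{z-1}/Γ(z)`. -/
def kernelExt (N : ℕ) (ψ : 𝓢(ℝ, ℂ)) (z : ℂ) : ℂ :=
  (Complex.Gamma (z + N))⁻¹ * ((-1) ^ N * mellin ((SchwartzMap.derivCLM ℂ ℂ)^[N] ψ) (z + N))

/-- The factor -(z + N) from integration by parts is compensated by the sign and by Γ(w + 1) = w
Γ(w) at w = z + N. -/
theorem kernelExt_succ (N : ℕ) (ψ : 𝓢(ℝ, ℂ)) {z : ℂ} (hz : 0 < z.re + N) :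
    kernelExt (N + 1) ψ z = kernelExt N ψ z := by
  have hz' : 0 < (z + N).re := by simpa using hz
  have hne : z + N ≠ 0 := fun h => by simp [h] at hz'
  rw [kernelExt, kernelExt, Function.iterate_succ_apply', Nat.cast_succ, ← add_assoc,
    Complex.Gamma_add_one _ hne, mellin_derivCLM _ hz', mul_inv, pow_succ]
  field_simp

theorem kernelExt_add (N k : ℕ) (ψ : 𝓢(ℝ, ℂ)) {z : ℂ} (hz : 0 < z.re + N) :
    kernelExt (N + k) ψ z = kernelExt N ψ z := by
  induction k with
  | zero => rfl
  | succ k ih =>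
    rw [← add_assoc, kernelExt_succ _ _ (by push_cast; linarith [k.cast_nonneg (α := ℝ)]), ih]

theorem iterate_derivCLM_apply (T : 𝓢'(ℝ, ℂ)) (N : ℕ) (ψ : 𝓢(ℝ, ℂ)) :
    (TemperedDistribution.derivCLM ℂ)^[N] T ψ
      = (-1) ^ N * T ((SchwartzMap.derivCLM ℂ ℂ)^[N] ψ) := by
  induction N generalizing T with
  | zero => simp
  | succ N ih =>
    rw [Function.iterate_succ_apply, ih, TemperedDistribution.derivCLM_apply_apply,
      Function.iterate_succ_apply', map_neg]
    ring

theorem kernelPos_apply {β : ℝ} (hβ : 0 < β) (ψ : 𝓢(ℝ, ℂ)) :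
    kernelPos β hβ ψ = (Complex.Gamma β)⁻¹ * mellin ψ β := by
  have := powerMeasure_hasTemperateGrowth hβ
  change ∫ t, ψ t ∂(powerMeasure β) = _
  rw [powerMeasure, integral_withDensity_eq_integral_toReal_smul (by fun_prop)
    (Filter.Eventually.of_forall fun _ => ENNReal.ofReal_lt_top), mellin, ← integral_const_mul]
  refine setIntegral_congr_fun measurableSet_Ioi fun t ht => ?_
  have ht' : 0 ≤ t := le_of_lt ht
  have h0 : 0 ≤ t ^ (β - 1) / Real.Gamma β :=
    div_nonneg (Real.rpow_nonneg ht' _) (Real.Gamma_pos_of_pos hβ).le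
  change (ENNReal.ofReal (t ^ (β - 1) / Real.Gamma β)).toReal • ψ t = _
  rw [ENNReal.toReal_ofReal h0, Complex.real_smul, Complex.ofReal_div, Complex.ofReal_cpow ht',
    ← Complex.Gamma_ofReal, smul_eq_mul]
  push_cast
  ring

/-- `kernel` uses the least admissible number of derivatives; any larger one gives the same value. A
fixed `N` can therefore serve a whole range of β, which makes the dependence on β visibly analytic.
-/
theorem kernel_apply {β : ℝ} {N : ℕ} (h : 0 < β + N) (ψ : 𝓢(ℝ, ℂ)) :
    kernel β ψ = kernelExt N ψ β := by
  by_cases hβ : 0 < β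
  · rw [kernel, dif_pos hβ, kernelPos_apply hβ]
    have := kernelExt_add 0 N ψ (z := β) (by simpa using hβ)
    rw [zero_add] at this
    rw [this]
    simp [kernelExt]
  · have h1 : 0 < β + (⌊-β⌋₊ + 1 : ℕ) := by
      push_cast
      linarith [Nat.lt_floor_add_one (-β)]
    have h2 : ⌊-β⌋₊ + 1 ≤ N := by
      rw [Nat.succ_le_iff, Nat.floor_lt (by linarith)]
      linarith
    obtain ⟨k, rfl⟩ := Nat.exists_eq_add_of_le h2
    rw [kernelExt_add _ _ _ (by simpa using h1), kernel, dif_neg hβ, iterate_derivCLM_apply,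
      kernelPos_apply, kernelExt]
    push_cast
    ring

theorem coe_iterate_derivCLM (N : ℕ) (ψ : 𝓢(ℝ, ℂ)) :
    ((SchwartzMap.derivCLM ℂ ℂ)^[N] ψ : ℝ → ℂ) = iteratedDeriv N ψ := by
  induction N with
  | zero => simp
  | succ N ih =>
    rw [Function.iterate_succ_apply', iteratedDeriv_succ, ← ih]
    funext t
    rw [SchwartzMap.derivCLM_apply]

theorem kernelExt_differentiableAt (N : ℕ) (ψ : 𝓢(ℝ, ℂ)) {z : ℂ} (hz : 0 < z.re + N) :
    DifferentiableAt ℂ (kernelExt N ψ) z := by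
  have h1 : DifferentiableAt ℂ (fun z : ℂ => (Complex.Gamma (z + N))⁻¹) z :=
    DifferentiableAt.comp (g := fun s : ℂ => (Complex.Gamma s)⁻¹) z
      (Complex.differentiable_one_div_Gamma (z + N)) (by fun_prop)
  have h2 : DifferentiableAt ℂ
      (fun z : ℂ => mellin ((SchwartzMap.derivCLM ℂ ℂ)^[N] ψ) (z + N)) z :=
    (schwartz_mellin_differentiableAt _ (by simpa using hz)).comp z (by fun_prop)
  exact h1.mul (h2.const_mul _)

theorem kernelExt_eq_zero {N : ℕ} {ψ : 𝓢(ℝ, ℂ)} (h : ∀ t > 0, ψ t = 0) (z : ℂ) :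
    kernelExt N ψ z = 0 := by
  have h1 : ∀ t ∈ Set.Ioi (0 : ℝ), iteratedDeriv N ψ t = 0 := by
    intro t ht
    have : (ψ : ℝ → ℂ) =ᶠ[𝓝 t] fun _ => 0 := by
      filter_upwards [Ioi_mem_nhds ht] with y hy using h y hy
    rw [this.iteratedDeriv_eq]
    simp
  rw [kernelExt, coe_iterate_derivCLM, mellin, setIntegral_congr_fun (g := fun _ => (0 : ℂ))
    measurableSet_Ioi fun t ht => by simp [h1 t ht]]
  simp

/-- `∫₀^∞ t^{u-1} e^{-st} dt = s^{-u} Γ(u)` for complex `s` in the right half-plane. -/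
theorem integral_rpow_mul_exp_neg {u : ℝ} (hu : 0 < u) {s : ℂ} (hs : 0 < s.re) :
    ∫ t in Set.Ioi (0 : ℝ), (t : ℂ) ^ ((u : ℂ) - 1) * Complex.exp (-s * t)
      = s ^ (-(u : ℂ)) * Complex.Gamma u := by
  set I : ℂ → ℂ := fun s =>
    ∫ t in Set.Ioi (0 : ℝ), (t : ℂ) ^ ((u : ℂ) - 1) * Complex.exp (-s * t) with hI
  have hreal : ∀ r : ℝ, 0 < r → I r = (r : ℂ) ^ (-(u : ℂ)) * Complex.Gamma u := by
    intro r hr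
    have := Complex.integral_cpow_mul_exp_neg_mul_Ioi (a := u) (by simpa using hu) hr
    simp only [hI, neg_mul]
    rw [this, one_div, Complex.inv_cpow, Complex.cpow_neg]
    rw [Complex.arg_ofReal_of_nonneg hr.le]
    exact Real.pi_pos.ne
  have hint : ∀ (v r : ℝ), 0 < v → 0 < r →
      IntegrableOn (fun t : ℝ => t ^ (v - 1) * Real.exp (-(r * t))) (Set.Ioi 0) := by
    intro v r hv hr
    have := integrableOn_rpow_mul_exp_neg_mul_rpow (s := v - 1) (p := 1) (by linarith) one_pos hr
    simpa using this
  have hnorm : ∀ (v : ℝ) (z : ℂ) (t : ℝ), 0 < t →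
      ‖(t : ℂ) ^ ((v : ℂ) - 1) * Complex.exp (-z * t)‖ = t ^ (v - 1) * Real.exp (-(z.re * t)) := by
    intro v z t ht
    rw [norm_mul, Complex.norm_cpow_eq_rpow_re_of_pos ht, Complex.norm_exp]
    simp
  have hmeas : ∀ z : ℂ, AEStronglyMeasurable
      (fun t : ℝ => (t : ℂ) ^ ((u : ℂ) - 1) * Complex.exp (-z * t))
      (volume.restrict (Set.Ioi 0)) := by
    intro z
    exact Measurable.aestronglyMeasurable (by fun_prop)
  have hdiff : ∀ z : ℂ, 0 < z.re → DifferentiableAt ℂ I z := by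
    intro z hz
    refine (hasDerivAt_integral_of_dominated_loc_of_deriv_le
      (F := fun (z : ℂ) (t : ℝ) => (t : ℂ) ^ ((u : ℂ) - 1) * Complex.exp (-z * t))
      (F' := fun (z : ℂ) (t : ℝ) => (t : ℂ) ^ ((u : ℂ) - 1) * (Complex.exp (-z * t) * -t))
      (bound := fun t : ℝ => t ^ (u + 1 - 1) * Real.exp (-(z.re / 2 * t)))
      (Metric.ball_mem_nhds z (half_pos hz)) (Filter.Eventually.of_forall hmeas) ?_ ?_ ?_ ?_
      ?_).2.differentiableAt
    · refine Integrable.mono' (hint u z.re hu hz) (hmeas z) ?_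
      filter_upwards [ae_restrict_mem measurableSet_Ioi] with t ht
      rw [hnorm u z t ht]
    · exact Measurable.aestronglyMeasurable (by fun_prop)
    · filter_upwards [ae_restrict_mem measurableSet_Ioi] with t ht y hy
      have ht' : (0 : ℝ) < t := ht
      have hy' := (Complex.abs_re_le_norm (y - z)).trans_lt (by simpa [dist_eq_norm] using hy)
      rw [Complex.sub_re] at hy'
      have hyr := abs_lt.1 hy'
      rw [← mul_assoc, norm_mul, hnorm u y t ht, norm_neg, Complex.norm_real,
        Real.norm_of_nonneg ht'.le, add_sub_cancel_right]
      calc t ^ (u - 1) * Real.exp (-(y.re * t)) * t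
          = t ^ u * Real.exp (-(y.re * t)) := by
            rw [mul_right_comm, ← Real.rpow_add_one ht'.ne', sub_add_cancel]
        _ ≤ _ := by
            gcongr
            linarith
    · exact hint (u + 1) (z.re / 2) (by linarith) (half_pos hz)
    · refine Filter.Eventually.of_forall fun t y _ => ?_
      have h3 : HasDerivAt (fun z : ℂ => -z * t) (-t) y := by
        simpa using (hasDerivAt_id y).neg.mul_const (t : ℂ)
      exact h3.cexp.const_mul _
  have hU : IsOpen {z : ℂ | 0 < z.re} := isOpen_lt continuous_const Complex.continuous_re
  have ha1 : AnalyticOnNhd ℂ I {z : ℂ | 0 < z.re} :=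
    DifferentiableOn.analyticOnNhd (fun z hz => (hdiff z hz).differentiableWithinAt) hU
  have ha2 : AnalyticOnNhd ℂ (fun z : ℂ => z ^ (-(u : ℂ)) * Complex.Gamma u)
      {z : ℂ | 0 < z.re} := by
    refine DifferentiableOn.analyticOnNhd (fun z hz => ?_) hU
    exact ((differentiableAt_id.cpow_const (Or.inl hz)).mul_const _).differentiableWithinAt
  -- Both sides are holomorphic in s and agree for real s > 0, where the Gamma integral is known;
  -- real points r > 1 accumulate at 1.
  refine ha1.eqOn_of_preconnected_of_frequently_eq ha2
    (convex_halfSpace_re_gt 0).isPreconnected (z₀ := 1) (by simp) ?_ hs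
  have hlim : Filter.Tendsto (fun r : ℝ => (r : ℂ)) (𝓝[>] 1) (𝓝[≠] 1) := by
    refine tendsto_nhdsWithin_iff.2 ⟨?_, ?_⟩
    · exact (Complex.continuous_ofReal.tendsto' 1 1 (by simp)).mono_left nhdsWithin_le_nhds
    · filter_upwards [self_mem_nhdsWithin] with r hr
      simpa using (ne_of_gt hr : r ≠ 1)
  refine hlim.frequently (Filter.Eventually.frequently ?_)
  filter_upwards [self_mem_nhdsWithin] with r hr
  exact hreal r (zero_lt_one.trans hr)

/-- On t > 0 the cutoff in `expTest` is 1, so N derivatives give (-s)^N e^{-st}. The signs cancel,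
and s^N is absorbed by s^{-(β+N)}. -/
theorem kernel_expTest (β : ℝ) {s : ℂ} (hs : 0 < s.re) :
    kernel β (expTest s hs) = s ^ (-(β : ℂ)) := by
  obtain ⟨N, hN⟩ := exists_nat_gt (-β)
  have h : 0 < β + N := by linarith
  have hs0 : s ≠ 0 := fun h => by simp [h] at hs
  have h1 : ∀ t ∈ Set.Ioi (0 : ℝ),
      iteratedDeriv N (expTest s hs) t = (-s) ^ N * Complex.exp (-s * t) := by
    intro t ht
    have : (expTest s hs : ℝ → ℂ) =ᶠ[𝓝 t] fun t => Complex.exp (-s * t) := by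
      filter_upwards [Ioi_mem_nhds ht] with y hy
      have hy' : (0 : ℝ) < y := hy
      change cut y * _ = _
      rw [cut_of_nonneg (by linarith), one_mul]
    rw [this.iteratedDeriv_eq, iteratedDeriv_cexp]
  have hG : Complex.Gamma (β + N) ≠ 0 :=
    Complex.Gamma_ne_zero_of_re_pos (by simpa using h)
  have h2 := integral_rpow_mul_exp_neg h hs
  rw [kernel_apply h, kernelExt, coe_iterate_derivCLM, mellin,
    setIntegral_congr_fun (g := fun t : ℝ =>
      (-s) ^ N * ((t : ℂ) ^ (((β + N : ℝ) : ℂ) - 1) * Complex.exp (-s * t)))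
    measurableSet_Ioi fun t ht => by simp [h1 t ht]; ring, integral_const_mul, h2]
  push_cast
  rw [neg_add, Complex.cpow_add _ _ hs0, Complex.cpow_neg s N, Complex.cpow_natCast, neg_pow s]
  field_simp
  rw [← pow_mul, mul_comm N 2, pow_mul]
  simp

end Kernel

/-! ### The distribution ∫ ϕ(α) f_{-α} dα -/

section SymbolDistribution

/-- This allows Cauchy's estimates to bound derivatives in the real order α. -/
theorem iteratedDeriv_comp_ofReal {H : ℂ → ℂ} {U : Set ℂ} (hU : IsOpen U)
    (hH : DifferentiableOn ℂ H U) (n : ℕ) {x : ℝ} (hx : (x : ℂ) ∈ U) :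
    iteratedDeriv n (fun x : ℝ => H x) x = iteratedDeriv n H x := by
  induction n generalizing x with
  | zero => simp
  | succ n ih =>
    rw [iteratedDeriv_succ, iteratedDeriv_succ]
    have h1 : iteratedDeriv n (fun x : ℝ => H x) =ᶠ[𝓝 x] fun x : ℝ => iteratedDeriv n H x := by
      filter_upwards [Complex.continuous_ofReal.continuousAt.preimage_mem_nhds (hU.mem_nhds hx)]
        with y hy using ih hy
    rw [h1.deriv_eq]
    have h2 : AnalyticAt ℂ (iteratedDeriv n H) x := by
      rw [iteratedDeriv_eq_iterate]
      exact (hH.analyticAt (hU.mem_nhds hx)).iterated_deriv n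
    exact h2.differentiableAt.hasDerivAt.comp_ofReal.deriv

theorem differentiableOn_kernelExt_neg (N : ℕ) (ψ : 𝓢(ℝ, ℂ)) :
    DifferentiableOn ℂ (fun z => kernelExt N ψ (-z)) {z : ℂ | z.re < N} := by
  intro z hz
  have hz' : z.re < N := hz
  have h1 : DifferentiableAt ℂ (kernelExt N ψ) (-z) :=
    kernelExt_differentiableAt N ψ (by simpa using hz')
  exact (h1.comp z (by fun_prop)).differentiableWithinAt

theorem isOpen_re_lt (c : ℝ) : IsOpen {z : ℂ | z.re < c} :=
  isOpen_lt Complex.continuous_re continuous_const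

theorem kernel_neg_eventuallyEq (ψ : 𝓢(ℝ, ℂ)) {N : ℕ} {α : ℝ} (h : α < N) :
    (fun α : ℝ => kernel (-α) ψ) =ᶠ[𝓝 α] fun α : ℝ => kernelExt N ψ (-(α : ℂ)) := by
  filter_upwards [Iio_mem_nhds h] with y hy
  have hy' : y < N := hy
  rw [kernel_apply (N := N) (by linarith), Complex.ofReal_neg]

/-- Needed because `pairing` has the default value 0 on functions that are not smooth. -/
theorem contDiff_kernel_neg (ψ : 𝓢(ℝ, ℂ)) : ContDiff ℝ ∞ fun α : ℝ => kernel (-α) ψ := by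
  rw [contDiff_iff_contDiffAt]
  intro α
  obtain ⟨N, hN⟩ := exists_nat_gt α
  refine ContDiffAt.congr_of_eventuallyEq ?_ (kernel_neg_eventuallyEq ψ hN)
  have h1 : ContDiffAt ℝ ∞ (fun z => kernelExt N ψ (-z)) (α : ℂ) :=
    ((differentiableOn_kernelExt_neg N ψ).analyticAt
      ((isOpen_re_lt N).mem_nhds (by simpa using hN))).contDiffAt.restrict_scalars ℝ
  exact h1.comp α Complex.ofRealCLM.contDiff.contDiffAt

/-- Uniform on the strip a ≤ Re u ≤ b: t^{a-1} dominates on (0, 1], and k > b powers of decay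
dominate on (1, ∞). -/
theorem norm_mellin_le {a : ℝ} (ha : 0 < a) (b : ℝ) :
    ∃ (C : ℝ) (k : ℕ), 0 ≤ C ∧ ∀ (h : ℝ → ℂ) (B : ℝ), 0 ≤ B → (∀ t, ‖h t‖ ≤ B) →
      (∀ t, |t| ^ k * ‖h t‖ ≤ B) → ∀ u : ℂ, a ≤ u.re → u.re ≤ b → ‖mellin h u‖ ≤ C * B := by
  obtain ⟨k, hk⟩ := exists_nat_gt b
  set g : ℝ → ℝ := fun t => if t ≤ 1 then t ^ (a - 1) else t ^ (b - 1 - k) with hg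
  have hgi : IntegrableOn g (Set.Ioi 0) := by
    rw [← Set.Ioc_union_Ioi_eq_Ioi zero_le_one]
    refine IntegrableOn.union ?_ ?_
    · have := intervalIntegral.intervalIntegrable_rpow' (a := 0) (b := 1)
        (show -1 < a - 1 by linarith)
      rw [intervalIntegrable_iff_integrableOn_Ioc_of_le zero_le_one] at this
      exact this.congr_fun (fun t ht => by simp [hg, ht.2]) measurableSet_Ioc
    · have := integrableOn_Ioi_rpow_of_lt (show b - 1 - k < -1 by linarith) one_pos
      exact this.congr_fun (fun t ht => by simp [hg, not_le.2 (show (1 : ℝ) < t from ht)]) measurableSet_Ioi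
  refine ⟨∫ t in Set.Ioi 0, g t, k, ?_, fun h B hB h0 hk' u hau hub => ?_⟩
  · refine setIntegral_nonneg measurableSet_Ioi fun t ht => ?_
    have ht' : (0 : ℝ) < t := ht
    simp only [hg]
    split_ifs <;> positivity
  · rw [mellin, ← integral_mul_const]
    refine norm_integral_le_of_norm_le (hgi.mul_const B) ?_
    filter_upwards [ae_restrict_mem measurableSet_Ioi] with t ht
    have ht' : (0 : ℝ) < t := ht
    rw [norm_smul, Complex.norm_cpow_eq_rpow_re_of_pos ht', Complex.sub_re, Complex.one_re]
    simp only [hg]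
    split_ifs with h1
    · refine mul_le_mul ?_ (h0 t) (norm_nonneg _) (by positivity)
      exact Real.rpow_le_rpow_of_exponent_ge ht' h1 (by linarith)
    · have h1' : 1 ≤ t := (not_le.1 h1).le
      calc t ^ (u.re - 1) * ‖h t‖ ≤ t ^ (b - 1) * ‖h t‖ := by gcongr
        _ = t ^ (b - 1 - k) * (|t| ^ k * ‖h t‖) := by
          rw [abs_of_pos ht', Real.rpow_sub ht' (b - 1), Real.rpow_natCast]
          field_simp
        _ ≤ _ := by
          gcongr
          exact hk' t

/-- The derivatives of `α ↦ ⟨f_{-α}, ψ⟩` are bounded near `[0, 1]` by a Schwartz seminorm of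
`ψ`. -/
theorem norm_iteratedDeriv_kernel_neg_le (n : ℕ) :
    ∃ (C : ℝ) (k : ℕ), 0 ≤ C ∧ ∀ (ψ : 𝓢(ℝ, ℂ)), ∀ j ≤ n,
      ∀ α ∈ Metric.closedBall (1 / 2 : ℝ) 2,
      ‖iteratedDeriv j (fun α : ℝ => kernel (-α) ψ) α‖ ≤
        C * (SchwartzMap.seminorm ℂ 0 4 ψ + SchwartzMap.seminorm ℂ k 4 ψ) := by
  -- The ball is [-3/2, 5/2], and a Cauchy circle of radius 1 stays in -5/2 ≤ Re z ≤ 7/2. With N = 4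
  -- this gives 1/2 ≤ Re(-z + 4) ≤ 13/2 and |-z + 4| ≤ 15/2 < 8, whence the constants here and in
  -- `hD`.
  obtain ⟨C, k, hC0, hC⟩ := norm_mellin_le (show (0 : ℝ) < 1 / 2 by norm_num) (13 / 2)
  obtain ⟨D, hD⟩ := (isCompact_closedBall (0 : ℂ) 8).exists_bound_of_continuousOn
    Complex.differentiable_one_div_Gamma.continuous.continuousOn
  have hD0 : 0 ≤ D := (norm_nonneg _).trans (hD 0 (by simp))
  refine ⟨n.factorial * (D * C), k, by positivity, fun ψ j hj α hα => ?_⟩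
  set B := SchwartzMap.seminorm ℂ 0 4 ψ + SchwartzMap.seminorm ℂ k 4 ψ with hB
  have hB0 : 0 ≤ B := add_nonneg (apply_nonneg _ _) (apply_nonneg _ _)
  rw [Metric.mem_closedBall, Real.dist_eq, abs_le] at hα
  have hα4 : α < (4 : ℕ) := by push_cast; linarith
  have e1 : iteratedDeriv j (fun α : ℝ => kernel (-α) ψ) α
      = iteratedDeriv j (fun z => kernelExt 4 ψ (-z)) (α : ℂ) := by
    rw [(kernel_neg_eventuallyEq ψ hα4).iteratedDeriv_eq]
    exact iteratedDeriv_comp_ofReal (H := fun z => kernelExt 4 ψ (-z)) (isOpen_re_lt _)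
      (differentiableOn_kernelExt_neg 4 ψ) j (by simpa using hα4)
  have hre : ∀ z ∈ Metric.closedBall (α : ℂ) 1, |z.re - α| ≤ 1 := fun z hz => by
    have := (Complex.abs_re_le_norm (z - α)).trans (by simpa [dist_eq_norm] using hz)
    simpa using this
  have hd : DiffContOnCl ℂ (fun z => kernelExt 4 ψ (-z)) (Metric.ball (α : ℂ) 1) :=
    (differentiableOn_kernelExt_neg 4 ψ).diffContOnCl_ball fun z hz => by
      have := (abs_le.1 (hre z hz)).2
      show z.re < (4 : ℕ)
      push_cast
      linarith
  have hbound : ∀ z ∈ Metric.sphere (α : ℂ) 1, ‖kernelExt 4 ψ (-z)‖ ≤ D * (C * B) := by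
    intro z hz
    have hz' := Metric.sphere_subset_closedBall hz
    have h1 := abs_le.1 (hre z hz')
    have h2 : (-z + (4 : ℕ)).re = 4 - z.re := by simp; ring
    rw [kernelExt, norm_mul, norm_mul, norm_pow, norm_neg, norm_one, one_pow, one_mul]
    refine mul_le_mul (hD _ ?_) ?_ (norm_nonneg _) hD0
    · rw [mem_closedBall_zero_iff]
      have h3 : ‖z‖ ≤ ‖z - α‖ + ‖(α : ℂ)‖ := by
        simpa using norm_add_le (z - α) (α : ℂ)
      have h4 : ‖z - α‖ = 1 := by simpa [dist_eq_norm] using hz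
      have h5 : ‖(α : ℂ)‖ ≤ 5 / 2 := by
        rw [Complex.norm_real, Real.norm_eq_abs, abs_le]
        constructor <;> linarith
      calc ‖-z + ((4 : ℕ) : ℂ)‖ ≤ ‖-z‖ + ‖((4 : ℕ) : ℂ)‖ := norm_add_le _ _
        _ ≤ 8 := by
          rw [norm_neg, Complex.norm_natCast]
          push_cast
          linarith
    · rw [coe_iterate_derivCLM]
      refine hC _ B hB0 (fun t => ?_) (fun t => ?_) _ ?_ ?_
      · have := SchwartzMap.le_seminorm' ℂ 0 4 ψ t
        rw [pow_zero, one_mul] at this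
        exact this.trans (le_add_of_nonneg_right (apply_nonneg _ _))
      · exact (SchwartzMap.le_seminorm' ℂ k 4 ψ t).trans
          (le_add_of_nonneg_left (apply_nonneg _ _))
      · rw [h2]; linarith
      · rw [h2]; linarith
  have key := Complex.norm_iteratedDeriv_le_of_forall_mem_sphere_norm_le j one_pos hd hbound
  rw [one_pow, div_one] at key
  rw [e1]
  calc _ ≤ (j.factorial : ℝ) * (D * (C * B)) := key
    _ ≤ (n.factorial : ℝ) * (D * (C * B)) := by
      gcongr
    _ = _ := by ring

variable (ϕ : 𝓓'((⊤ : Opens ℝ), ℂ))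

/-- All functions `cutTest f hf` are supported in one compact ball, the closed support of
`pairingCutoff`. There ϕ has finite order, and Leibniz removes the cutoff. -/
theorem norm_cutTest_le :
    ∃ (n : ℕ) (C : ℝ), 0 ≤ C ∧ ∀ (f : ℝ → ℝ) (hf : ContDiff ℝ ∞ f) (B : ℝ), 0 ≤ B →
      (∀ j ≤ n, ∀ α ∈ Metric.closedBall (1 / 2 : ℝ) 2, ‖iteratedFDeriv ℝ j f α‖ ≤ B) →
      ‖ϕ (cutTest f hf)‖ ≤ C * B := by
  set K : Compacts ℝ := ⟨Metric.closedBall (1 / 2) 2, isCompact_closedBall _ _⟩ with hK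
  have hKtop : (K : Set ℝ) ⊆ ((⊤ : Opens ℝ) : Set ℝ) := by simp
  set L : 𝓓_{K}(ℝ, ℝ) →ₗ[ℝ] ℂ :=
    ϕ.toLinearMap.comp (TestFunction.ofSupportedInCLM ℝ hKtop).toLinearMap with hL
  have hLc : Continuous L :=
    ϕ.continuous.comp (TestFunction.ofSupportedInCLM ℝ hKtop).continuous
  obtain ⟨s, C, -, hC⟩ := Seminorm.bound_of_continuous
    (ContDiffMapSupportedIn.withSeminorms ℝ ℝ ℝ ⊤ K) ((normSeminorm ℝ ℂ).comp L)
    (continuous_norm.comp hLc)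
  set n := s.sup id with hn
  have hb : ∀ i : ℕ, ∃ D : ℝ, 0 ≤ D ∧ ∀ α, ‖iteratedFDeriv ℝ i pairingCutoff α‖ ≤ D := by
    intro i
    have h1 : Continuous (iteratedFDeriv ℝ i pairingCutoff) :=
      (pairingCutoff.contDiff (n := ⊤)).continuous_iteratedFDeriv (by exact_mod_cast le_top)
    obtain ⟨D, hD⟩ := h1.bounded_above_of_compact_support
      (pairingCutoff.hasCompactSupport.iteratedFDeriv i)
    exact ⟨D, (norm_nonneg _).trans (hD 0), hD⟩
  choose D hD0 hD using hb
  refine ⟨n, C * ∑ i ∈ s, ∑ j ∈ Finset.range (i + 1), (i.choose j : ℝ) * D j,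
    mul_nonneg C.2 (Finset.sum_nonneg fun i _ => Finset.sum_nonneg fun j _ =>
      mul_nonneg (by positivity) (hD0 j)), fun f hf B hB h => ?_⟩
  have hsm : ContDiff ℝ ∞ fun α => pairingCutoff α * f α := pairingCutoff.contDiff.mul hf
  set g : 𝓓_{K}(ℝ, ℝ) := ContDiffMapSupportedIn.of_support_subset hsm (by
    refine (Function.support_mul_subset_left _ _).trans ?_
    rw [pairingCutoff.support_eq]
    exact Metric.ball_subset_closedBall) with hg
  have e : ϕ (cutTest f hf) = L g := rfl
  have h1 : ‖L g‖ ≤ C * (s.sup (ContDiffMapSupportedIn.seminorm ℝ ℝ ℝ ⊤ K)) g := hC g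
  have h2 : (s.sup (ContDiffMapSupportedIn.seminorm ℝ ℝ ℝ ⊤ K)) g
      ≤ ∑ i ∈ s, ContDiffMapSupportedIn.seminorm ℝ ℝ ℝ ⊤ K i g := by
    have := Seminorm.finset_sup_le_sum (ContDiffMapSupportedIn.seminorm ℝ ℝ ℝ ⊤ K) s g
    simpa using this
  rw [e, mul_assoc, Finset.sum_mul]
  refine h1.trans (mul_le_mul_of_nonneg_left (h2.trans (Finset.sum_le_sum fun i hi => ?_)) C.2)
  rw [ContDiffMapSupportedIn.seminorm_top_le_iff ℝ (mul_nonneg (Finset.sum_nonneg fun j _ =>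
    mul_nonneg (by positivity) (hD0 j)) hB)]
  intro α hα
  have hin : i ≤ n := Finset.le_sup (f := id) hi
  have leib := norm_iteratedFDeriv_mul_le (N := ∞) pairingCutoff.contDiff hf α (n := i)
    (by exact_mod_cast le_top)
  refine leib.trans ?_
  rw [Finset.sum_mul]
  refine Finset.sum_le_sum fun j _ => ?_
  refine mul_le_mul ?_ (h _ ((Nat.sub_le _ _).trans hin) α hα) (norm_nonneg _)
    (mul_nonneg (by positivity) (hD0 j))
  exact mul_le_mul_of_nonneg_left (hD j α) (by positivity)

theorem norm_pairing_le :
    ∃ (n : ℕ) (C : ℝ), 0 ≤ C ∧ ∀ (f : ℝ → ℂ), ContDiff ℝ ∞ f → ∀ B : ℝ, 0 ≤ B →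
      (∀ j ≤ n, ∀ α ∈ Metric.closedBall (1 / 2 : ℝ) 2, ‖iteratedDeriv j f α‖ ≤ B) →
      ‖pairing ϕ f‖ ≤ C * B := by
  obtain ⟨n, C, hC0, hC⟩ := norm_cutTest_le ϕ
  refine ⟨n, 2 * C, by positivity, fun f hf B hB h => ?_⟩
  have hcomp : ∀ (l : ℂ →L[ℝ] ℝ), ‖l‖ ≤ 1 → ∀ j ≤ n, ∀ α ∈ Metric.closedBall (1 / 2 : ℝ) 2,
      ‖iteratedFDeriv ℝ j (l ∘ f) α‖ ≤ B := by
    intro l hl j hj α hα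
    refine (l.norm_iteratedFDeriv_comp_left hf.contDiffAt (by exact_mod_cast le_top)).trans ?_
    rw [norm_iteratedFDeriv_eq_norm_iteratedDeriv]
    exact (mul_le_of_le_one_left (norm_nonneg _) hl).trans (h j hj α hα)
  have h1 := hC _ (Complex.reCLM.contDiff.comp hf) B hB
    (hcomp Complex.reCLM (by simp))
  have h2 := hC _ (Complex.imCLM.contDiff.comp hf) B hB
    (hcomp Complex.imCLM (by simp))
  rw [pairing, dif_pos hf]
  refine (norm_add_le _ _).trans ?_
  rw [norm_mul, Complex.norm_I, one_mul, two_mul, add_mul]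
  exact add_le_add h1 h2

theorem pairing_add {f g : ℝ → ℂ} (hf : ContDiff ℝ ∞ f) (hg : ContDiff ℝ ∞ g) :
    pairing ϕ (fun α => f α + g α) = pairing ϕ f + pairing ϕ g := by
  have hfg : ContDiff ℝ ∞ fun α => f α + g α := hf.add hg
  rw [pairing, pairing, pairing, dif_pos hf, dif_pos hg, dif_pos hfg]
  have e1 : cutTest (fun α => (f α + g α).re) (Complex.reCLM.contDiff.comp hfg)
      = cutTest (fun α => (f α).re) (Complex.reCLM.contDiff.comp hf)
        + cutTest (fun α => (g α).re) (Complex.reCLM.contDiff.comp hg) := by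
    ext α
    simp [cutTest, mul_add]
  have e2 : cutTest (fun α => (f α + g α).im) (Complex.imCLM.contDiff.comp hfg)
      = cutTest (fun α => (f α).im) (Complex.imCLM.contDiff.comp hf)
        + cutTest (fun α => (g α).im) (Complex.imCLM.contDiff.comp hg) := by
    ext α
    simp [cutTest, mul_add]
  rw [e1, e2, map_add, map_add]
  ring

/-- ϕ is only real linear on real test functions; complex linearity comes from the way `pairing`
combines real and imaginary parts. -/
theorem pairing_const_mul (c : ℂ) {f : ℝ → ℂ} (hf : ContDiff ℝ ∞ f) :
    pairing ϕ (fun α => c * f α) = c * pairing ϕ f := by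
  have hcf : ContDiff ℝ ∞ fun α => c * f α := contDiff_const.mul hf
  rw [pairing, pairing, dif_pos hf, dif_pos hcf]
  have e1 : cutTest (fun α => (c * f α).re) (Complex.reCLM.contDiff.comp hcf)
      = c.re • cutTest (fun α => (f α).re) (Complex.reCLM.contDiff.comp hf)
        - c.im • cutTest (fun α => (f α).im) (Complex.imCLM.contDiff.comp hf) := by
    ext α
    simp [cutTest]
    ring
  have e2 : cutTest (fun α => (c * f α).im) (Complex.imCLM.contDiff.comp hcf)
      = c.re • cutTest (fun α => (f α).im) (Complex.imCLM.contDiff.comp hf)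
        + c.im • cutTest (fun α => (f α).re) (Complex.reCLM.contDiff.comp hf) := by
    ext α
    simp [cutTest]
    ring
  rw [e1, e2, map_sub, map_add, map_smul, map_smul, map_smul, map_smul]
  simp only [Complex.real_smul]
  nth_rewrite 5 [← Complex.re_add_im c]
  linear_combination (-(c.im : ℂ) * ϕ (cutTest (fun α => (f α).im) (Complex.imCLM.contDiff.comp hf))) * Complex.I_sq

/-- The distribution `∫ ϕ(α) f_{-α} dα`, whose Laplace transform is the symbol of `ϕ`. -/
def symbolDist : 𝓢'(ℝ, ℂ) :=
  ContinuousLinearMap.toPointwiseConvergenceCLM _ _ _ _ <|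
    SchwartzMap.mkCLMtoNormedSpace (σ := RingHom.id ℂ)
      (fun ψ : 𝓢(ℝ, ℂ) => pairing ϕ fun α => kernel (-α) ψ)
      (fun ψ χ => by
        simp only [map_add]
        exact pairing_add ϕ (contDiff_kernel_neg ψ) (contDiff_kernel_neg χ))
      (fun c ψ => by
        simp only [map_smul, smul_eq_mul, RingHom.id_apply]
        exact pairing_const_mul ϕ c (contDiff_kernel_neg ψ))
      (by
        -- The order n of ϕ affects only the number of α-derivatives. Each is bounded by the same
        -- type of seminorms of ψ, with four derivatives, since Cauchy's estimates cost none in t.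
        obtain ⟨n, C, hC0, hC⟩ := norm_pairing_le ϕ
        obtain ⟨D, k, hD0, hD⟩ := norm_iteratedDeriv_kernel_neg_le n
        refine ⟨{(0, 4), (k, 4)}, C * (D * 2), by positivity, fun ψ => ?_⟩
        have h1 : SchwartzMap.seminorm ℂ 0 4 ψ
            ≤ (({(0, 4), (k, 4)} : Finset (ℕ × ℕ)).sup (schwartzSeminormFamily ℂ ℝ ℂ)) ψ :=
          Seminorm.le_def.1 (Finset.le_sup (f := schwartzSeminormFamily ℂ ℝ ℂ)
            (show (0, 4) ∈ ({(0, 4), (k, 4)} : Finset (ℕ × ℕ)) by simp)) ψ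
        have h2 : SchwartzMap.seminorm ℂ k 4 ψ
            ≤ (({(0, 4), (k, 4)} : Finset (ℕ × ℕ)).sup (schwartzSeminormFamily ℂ ℝ ℂ)) ψ :=
          Seminorm.le_def.1 (Finset.le_sup (f := schwartzSeminormFamily ℂ ℝ ℂ)
            (show (k, 4) ∈ ({(0, 4), (k, 4)} : Finset (ℕ × ℕ)) by simp)) ψ
        refine (hC _ (contDiff_kernel_neg ψ) _
          (mul_nonneg hD0 (add_nonneg (apply_nonneg _ _) (apply_nonneg _ _))) (hD ψ)).trans ?_
        rw [mul_assoc, mul_assoc]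
        gcongr
        linarith)

theorem symbolDist_apply (ψ : 𝓢(ℝ, ℂ)) :
    symbolDist ϕ ψ = pairing ϕ fun α => kernel (-α) ψ := rfl

theorem symbolDist_causal : Distribution.IsVanishingOn (symbolDist ϕ) (Set.Iio (0 : ℝ)) := by
  intro ψ hψ
  have h0 : ∀ t > 0, ψ t = 0 := fun t ht => by
    by_contra hn
    have : t < 0 := hψ (subset_tsupport _ hn)
    linarith
  rw [symbolDist_apply]
  -- Both sides are zero; the factor 0 lets homogeneity of `pairing` give the value 0.
  have h1 : (fun α : ℝ => kernel (-α) ψ) = fun α => 0 * kernel (-α) ψ := by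
    funext α
    obtain ⟨N, hN⟩ := exists_nat_gt α
    rw [kernel_apply (N := N) (by linarith), kernelExt_eq_zero h0, mul_zero]
  rw [h1, pairing_const_mul ϕ 0 (contDiff_kernel_neg ψ), zero_mul]

theorem laplace_symbolDist {s : ℂ} (hs : 0 < s.re) :
    laplace (symbolDist ϕ) s hs = symbol ϕ s := by
  rw [laplace, symbolDist_apply, symbol]
  congr 1
  funext α
  rw [kernel_expTest]
  simp

/-- Definitional, because each fractional derivative is `kernel (-α)` applied to one and the same
slice `timePairing y φ`. -/
theorem distOrderDeriv_eq (y : 𝓢'(ℝ × ℝ, ℂ)) (φ : 𝓢(ℝ × ℝ, ℂ)) :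
    distOrderDeriv ϕ y φ = timeConv (symbolDist ϕ) y φ := rfl

end SymbolDistribution

/-! ### Solving the constitutive law and substituting into the equation of motion -/

section Equivalence

variable {ϕσ ϕε : 𝓓'((⊤ : Opens ℝ), ℂ)} {Λ : 𝓢'(ℝ, ℂ)} {σ ε v w : 𝓢'(ℝ × ℝ, ℂ)}

theorem IsCausal.partialX (hw : IsCausal w) : IsCausal (partialX w) :=
  Distribution.TemperedDistribution.IsVanishingOn.lineDerivOp hw _

theorem timeShift_lineDeriv (τ : ℝ) (φ : 𝓢(ℝ × ℝ, ℂ)) (m : ℝ × ℝ) :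
    ∂_{m} (timeShift τ φ) = timeShift τ (∂_{m} φ) := by
  ext p
  simp only [timeShift_coe, SchwartzMap.lineDerivOp_apply_eq_fderiv]
  rw [fderiv_comp_add_right]

theorem timeCutoff_lineDeriv (φ : 𝓢(ℝ × ℝ, ℂ)) :
    ∂_{((1 : ℝ), (0 : ℝ))} (timeCutoff φ) = timeCutoff (∂_{((1 : ℝ), (0 : ℝ))} φ) := by
  ext p
  rw [timeCutoff_apply, SchwartzMap.lineDerivOp_apply_eq_fderiv,
    SchwartzMap.lineDerivOp_apply_eq_fderiv]
  have e : (timeCutoff φ : ℝ × ℝ → ℂ) = fun q => cut q.2 * φ q := funext (timeCutoff_apply φ)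
  have h1 : HasFDerivAt (fun q : ℝ × ℝ => cut q.2)
      ((fderiv ℝ cut p.2).comp (ContinuousLinearMap.snd ℝ ℝ ℝ)) p :=
    (cut_contDiff.differentiable (by simp) p.2).hasFDerivAt.comp p hasFDerivAt_snd
  have h2 : HasFDerivAt (fun q : ℝ × ℝ => cut q.2 * φ q) _ p :=
    h1.mul φ.differentiableAt.hasFDerivAt
  rw [e, h2.fderiv]
  simp

/-- The shift and both cutoffs inside `timePairing` involve time only, so ∂/∂x passes through them.
-/
theorem partialX_timeConv (Λ : 𝓢'(ℝ, ℂ)) (w : 𝓢'(ℝ × ℝ, ℂ)) :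
    partialX (timeConv Λ w) = timeConv Λ (partialX w) := by
  ext φ
  simp only [partialX, TemperedDistribution.lineDerivOp_apply_apply, timeConv_apply]
  congr 1
  ext τ
  simp only [timePairing_apply, TemperedDistribution.lineDerivOp_apply_apply,
    timeCutoff_lineDeriv, timeShift_lineDeriv, map_neg, neg_apply, mul_neg]

theorem constitutiveLaw_iff_timeConv :
    ConstitutiveLaw ϕσ ϕε σ ε ↔ timeConv (symbolDist ϕσ) σ = timeConv (symbolDist ϕε) ε := by
  constructor
  · intro h
    ext φ
    exact h φ
  · intro h φ
    rw [distOrderDeriv_eq, distOrderDeriv_eq, h]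

theorem constitutiveLaw_iff (A1 : IsInverseLaplaceQuotient (symbol ϕε) (symbol ϕσ) Λ)
    (hσ : IsCausal σ) (hε : IsCausal ε) :
    ConstitutiveLaw ϕσ ϕε σ ε ↔ σ = timeConv Λ ε := by
  rw [constitutiveLaw_iff_timeConv]
  obtain ⟨s₀, hs₀, hne⟩ := A1.denom_ne_zero
  -- A1 gives Λ's transform only where Φσ is nonzero, and guarantees one such point. Continuity of
  -- Φσ, as a Laplace transform, supplies a neighbourhood, which suffices for
  -- `eq_of_sliceTransform`.
  have hnear : ∀ᶠ s in 𝓝 s₀, ∃ hs : 0 < s.re, symbol ϕσ s ≠ 0 ∧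
      laplace Λ s hs = symbol ϕε s / symbol ϕσ s := by
    have h1 := eventually_laplace_ne_zero (symbolDist_causal ϕσ) hs₀
      (by rwa [laplace_symbolDist])
    filter_upwards [h1, (isOpen_lt continuous_const Complex.continuous_re).mem_nhds hs₀] with s h hs
    have h2 := h hs
    rw [laplace_symbolDist] at h2
    exact ⟨hs, h2, A1.laplace_eq s hs h2⟩
  constructor
  · intro h
    refine eq_of_sliceTransform hσ (isCausal_timeConv A1.causal hε) hs₀ fun R φ hφ => ?_
    filter_upwards [hnear] with s ⟨hs, h0, hΛ⟩
    have h3 := sliceTransform_timeConv (symbolDist_causal ϕσ) hσ hφ hs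
    rw [h, sliceTransform_timeConv (symbolDist_causal ϕε) hε hφ hs, laplace_symbolDist,
      laplace_symbolDist] at h3
    rw [sliceTransform_timeConv A1.causal hε hφ hs, hΛ, div_mul_eq_mul_div, h3,
      mul_div_cancel_left₀ _ h0]
  · intro h
    refine eq_of_sliceTransform (isCausal_timeConv (symbolDist_causal ϕσ) hσ)
      (isCausal_timeConv (symbolDist_causal ϕε) hε) hs₀ fun R φ hφ => ?_
    filter_upwards [hnear] with s ⟨hs, h0, hΛ⟩
    rw [sliceTransform_timeConv (symbolDist_causal ϕσ) hσ hφ hs, h,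
      sliceTransform_timeConv A1.causal hε hφ hs,
      sliceTransform_timeConv (symbolDist_causal ϕε) hε hφ hs, laplace_symbolDist,
      laplace_symbolDist, hΛ, ← mul_assoc, mul_div_cancel₀ _ h0]

theorem eqForPositiveTime_iff_sub_eq_zero :
    EqForPositiveTime v w ↔ EqForPositiveTime (w - v) 0 := by
  have key : ∀ φ : 𝓢(ℝ × ℝ, ℂ), (v - w) φ = 0 ↔ (w - v - 0) φ = 0 := fun φ => by
    rw [sub_zero, ← neg_sub w v]
    exact neg_eq_zero
  exact ⟨fun h φ hφ => (key φ).1 (h φ hφ), fun h φ hφ => (key φ).2 (h φ hφ)⟩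

theorem isSystemSolution_iff (A1 : IsInverseLaplaceQuotient (symbol ϕε) (symbol ϕσ) Λ)
    (hσ : IsCausal σ) (hε : IsCausal ε) (u : 𝓢'(ℝ × ℝ, ℂ)) :
    IsSystemSolution ϕσ ϕε u σ ε ↔
      IsWaveSolution Λ u ∧ ε = partialX u ∧ σ = timeConv Λ ε := by
  have key : ε = partialX u → σ = timeConv Λ ε →
      (EqForPositiveTime (partialX σ) (partialT (partialT u)) ↔ IsWaveSolution Λ u) := by
    rintro rfl rfl
    rw [IsWaveSolution, eqForPositiveTime_iff_sub_eq_zero, partialX_timeConv]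
  constructor
  · rintro ⟨hm, hc, hs⟩
    have hΛ := (constitutiveLaw_iff A1 hσ hε).1 hc
    exact ⟨(key hs hΛ).1 hm, hs, hΛ⟩
  · rintro ⟨hw, hs, hΛ⟩
    exact ⟨(key hs hΛ).2 hw, (constitutiveLaw_iff A1 hσ hε).2 hΛ, hs⟩

theorem isCauchySystemSolution_iff (A1 : IsInverseLaplaceQuotient (symbol ϕε) (symbol ϕσ) Λ)
    (hσ : IsCausal σ) (hε : IsCausal ε) (u₀ v₀ : 𝓢'(ℝ, ℂ)) (u : 𝓢'(ℝ × ℝ, ℂ)) :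
    IsCauchySystemSolution ϕσ ϕε u₀ v₀ u σ ε ↔
      IsCauchyWaveSolution Λ u₀ v₀ u ∧ ε = partialX u ∧ σ = timeConv Λ ε := by
  have key : ε = partialX u → σ = timeConv Λ ε →
      (partialX σ + initialSource u₀ v₀ = partialT (partialT u) ↔
        IsCauchyWaveSolution Λ u₀ v₀ u) := by
    rintro rfl rfl
    rw [IsCauchyWaveSolution, partialX_timeConv, sub_eq_iff_eq_add', eq_comm]
  constructor
  · rintro ⟨hm, hc, hs⟩
    have hΛ := (constitutiveLaw_iff A1 hσ hε).1 hc
    exact ⟨(key hs hΛ).1 hm, hs, hΛ⟩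
  · rintro ⟨hw, hs, hΛ⟩
    exact ⟨(key hs hΛ).2 hw, (constitutiveLaw_iff A1 hσ hε).2 hΛ, hs⟩

end Equivalence

end

end FracWave

theorem mainTheorem5
    (ϕσ ϕε : 𝓓'((⊤ : TopologicalSpace.Opens ℝ), ℂ))
    (hσ : Distribution.dsupport ϕσ ⊆ Set.Icc (0 : ℝ) 1)
    (hε : Distribution.dsupport ϕε ⊆ Set.Icc (0 : ℝ) 1)
    (Λ : 𝓢'(ℝ, ℂ))
    (A1 : IsInverseLaplaceQuotient (symbol ϕε) (symbol ϕσ) Λ) :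
    ((∀ u σ ε : 𝓢'(ℝ × ℝ, ℂ), IsCausal u → IsCausal σ → IsCausal ε →
        (IsSystemSolution ϕσ ϕε u σ ε ↔
          IsWaveSolution Λ u ∧ ε = partialX u ∧ σ = timeConv Λ ε)) ∧
      (∀ u : 𝓢'(ℝ × ℝ, ℂ), IsCausal u →
        (IsWaveSolution Λ u ↔
          ∃ σ ε : 𝓢'(ℝ × ℝ, ℂ), IsCausal σ ∧ IsCausal ε ∧ IsSystemSolution ϕσ ϕε u σ ε))) ∧
    (∀ u₀ v₀ : 𝓢'(ℝ, ℂ),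
      (∀ u σ ε : 𝓢'(ℝ × ℝ, ℂ), IsCausal u → IsCausal σ → IsCausal ε →
        (IsCauchySystemSolution ϕσ ϕε u₀ v₀ u σ ε ↔
          IsCauchyWaveSolution Λ u₀ v₀ u ∧ ε = partialX u ∧ σ = timeConv Λ ε)) ∧
      (∀ u : 𝓢'(ℝ × ℝ, ℂ), IsCausal u →
        (IsCauchyWaveSolution Λ u₀ v₀ u ↔
          ∃ σ ε : 𝓢'(ℝ × ℝ, ℂ), IsCausal σ ∧ IsCausal ε ∧
            IsCauchySystemSolution ϕσ ϕε u₀ v₀ u σ ε))) := by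
  refine ⟨⟨fun u σ ε _ hσ' hε' => isSystemSolution_iff A1 hσ' hε' u, fun u hu => ?_⟩,
    fun u₀ v₀ => ⟨fun u σ ε _ hσ' hε' => isCauchySystemSolution_iff A1 hσ' hε' u₀ v₀ u,
      fun u hu => ?_⟩⟩
  · refine ⟨fun h => ?_, fun ⟨σ, ε, hσ', hε', h⟩ => ((isSystemSolution_iff A1 hσ' hε' u).1 h).1⟩
    -- The witnesses are ε = ∂ₓu and σ = Λ *ₜ ∂ₓu; both are causal because u and Λ are.
    have hc := isCausal_timeConv A1.causal hu.partialX
    exact ⟨_, _, hc, hu.partialX, (isSystemSolution_iff A1 hc hu.partialX u).2 ⟨h, rfl, rfl⟩⟩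
  · refine ⟨fun h => ?_,
      fun ⟨σ, ε, hσ', hε', h⟩ => ((isCauchySystemSolution_iff A1 hσ' hε' u₀ v₀ u).1 h).1⟩
    have hc := isCausal_timeConv A1.causal hu.partialX
    exact ⟨_, _, hc, hu.partialX,
      (isCauchySystemSolution_iff A1 hc hu.partialX u₀ v₀ u).2 ⟨h, rfl, rfl⟩⟩
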